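/- Let $n\ge 1$, let $\sigma$ be a nonsingular real $n\times n$ matrix and let $A$ be a real symmetric $n\times n$ matrix. For $\lambda\in\mathbb{R}$ consider on $\mathbb{R}^n$ the equation $$\max\Big\{\lambda-\tfrac12\operatorname{tr}\Big[\sigma\sigma^t\big(A+A\,D^2u\,A+(x+A\,Du)\otimes(x+A\,Du)\big)\Big],\ \max_{1\le i\le n}|u_{x_i}|-1\Big\}=0,\qquad(\ast)$$ where $a\otimes b$ is the matrix with entries $a_ib_j$. For $\lambda\in\mathbb{R}$, $x,p\in\mathbb{R}^n$ and a symmetric matrix $X$ write $$F_\lambda(x,p,X)=\max\Big\{\lambda-\tfrac12\operatorname{tr}\Big[\sigma\sigma^t\big(A+AXA+(x+Ap)\otimes(x+Ap)\big)\Big],\ \max_{1\le i\le n}|p_i|-1\Big\}.$$ An upper semicontinuous function $u:\mathbb{R}^n\to\mathbb{R}$ is a viscosity subsolution of $(\ast)$ with eigenvalue $\lambda$ if $F_\lambda(x_0,D\varphi(x_0),D^2\varphi(x_0))\le 0$ whenever $\varphi\in C^2(\mathbb{R}^n)$ and $u-\varphi$ has a local maximum at $x_0$. A lower semicontinuous function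 $v:\mathbb{R}^n\to\mathbb{R}$ is a viscosity supersolution of $(\ast)$ with eigenvalue $\mu$ if $F_\mu(y_0,D\psi(y_0),D^2\psi(y_0))\ge 0$ whenever $\psi\in C^2(\mathbb{R}^n)$ and $v-\psi$ has a local minimum at $y_0$. A continuous function is a viscosity solution with eigenvalue $\lambda$ if it is both a subsolution and a supersolution with eigenvalue $\lambda$. Proposition 2.2. Suppose $u$ is a viscosity subsolution of $(\ast)$ with eigenvalue $\lambda$ and $v$ is a viscosity supersolution of $(\ast)$ with eigenvalue $\mu$. If $$\limsup_{|x|\to\infty}\frac{u(x)}{\sum_{i=1}^n|x_i|}\le 1\le\liminf_{|x|\to\infty}\frac{v(x)}{\sum_{i=1}^n|x_i|}$$ (the limits being taken in $[-\infty,\infty]$), then $\lambda\le\mu$. In particular, there is at most one $\lambda\in\mathbb{R}$ for which $(\ast)$ has a viscosity solution $u$ with eigenvalue $\lambda$ satisfying $\lim_{|x|\to\infty}u(x)/\sum_{i=1}^n|x_i|=1$. -/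

import Mathlib

open Filter Topology

noncomputable section

namespace CorrectorEigenvalue

/-- The `i`-th partial derivative of `f` at `x`. -/
def partialDeriv {n : ℕ} (i : Fin n) (f : EuclideanSpace ℝ (Fin n) → ℝ)
    (x : EuclideanSpace ℝ (Fin n)) : ℝ :=
  fderiv ℝ f x (EuclideanSpace.single i 1)

/-- The gradient `Df(x)`, as the vector of partial derivatives. -/
def grad {n : ℕ} (f : EuclideanSpace ℝ (Fin n) → ℝ) (x : EuclideanSpace ℝ (Fin n)) :
    Fin n → ℝ :=
  fun i => partialDeriv i f x

/-- The Hessian matrix `D²f(x)`, with entries the second partial derivatives. -/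
def hess {n : ℕ} (f : EuclideanSpace ℝ (Fin n) → ℝ) (x : EuclideanSpace ℝ (Fin n)) :
    Matrix (Fin n) (Fin n) ℝ :=
  Matrix.of fun i j => partialDeriv i (partialDeriv j f) x

/-- The left-hand side of the equation at the point `x`, with `p` in place of `Du(x)` and `X` in
place of `D²u(x)`:
`max { lam - (1/2) tr σσᵗ (A + A X A + (x + A p) ⊗ (x + A p)), max_i |p_i| - 1 }`. -/
def correctorOp {n : ℕ} (σ A : Matrix (Fin n) (Fin n) ℝ) (lam : ℝ)
    (x : EuclideanSpace ℝ (Fin n)) (p : Fin n → ℝ) (X : Matrix (Fin n) (Fin n) ℝ) : ℝ :=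
  max
    (lam - (1 / 2 : ℝ) * (σ * σ.transpose * (A + A * X * A +
      Matrix.vecMulVec (x.ofLp + A.mulVec p) (x.ofLp + A.mulVec p))).trace)
    ((⨆ i, |p i|) - 1)

/-- `u` is a viscosity subsolution with eigenvalue `lam`. -/
def IsSubsolution {n : ℕ} (σ A : Matrix (Fin n) (Fin n) ℝ) (lam : ℝ)
    (u : EuclideanSpace ℝ (Fin n) → ℝ) : Prop :=
  UpperSemicontinuous u ∧
    ∀ (x : EuclideanSpace ℝ (Fin n)) (φ : EuclideanSpace ℝ (Fin n) → ℝ),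
      ContDiff ℝ 2 φ → IsLocalMax (fun y => u y - φ y) x →
        correctorOp σ A lam x (grad φ x) (hess φ x) ≤ 0

/-- `v` is a viscosity supersolution with eigenvalue `mu`. -/
def IsSupersolution {n : ℕ} (σ A : Matrix (Fin n) (Fin n) ℝ) (mu : ℝ)
    (v : EuclideanSpace ℝ (Fin n) → ℝ) : Prop :=
  LowerSemicontinuous v ∧
    ∀ (x : EuclideanSpace ℝ (Fin n)) (ψ : EuclideanSpace ℝ (Fin n) → ℝ),
      ContDiff ℝ 2 ψ → IsLocalMin (fun y => v y - ψ y) x →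
        0 ≤ correctorOp σ A mu x (grad ψ x) (hess ψ x)

/-- `u` is a (continuous) viscosity solution with eigenvalue `lam`. -/
def IsSolution {n : ℕ} (σ A : Matrix (Fin n) (Fin n) ℝ) (lam : ℝ)
    (u : EuclideanSpace ℝ (Fin n) → ℝ) : Prop :=
  Continuous u ∧ IsSubsolution σ A lam u ∧ IsSupersolution σ A lam u

/-- The quotient `u(x) / ∑ |x_i|`; its value at `0` plays no role in the limits at infinity. -/
def growthRatio {n : ℕ} (u : EuclideanSpace ℝ (Fin n) → ℝ) (x : EuclideanSpace ℝ (Fin n)) : ℝ :=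
  u x / ∑ i, |x i|

end CorrectorEigenvalue

end

/-!
The classical way to compare a viscosity subsolution `u` with a supersolution `v` doubles the
variables and needs a theorem on sums of semicontinuous functions.  Here the equation has enough
structure to replace `u` by smooth functions, after which a single test function suffices.

*Smoothing the subsolution.*  The constraint `|∂_i u| ≤ 1` together with the growth at infinity
makes `u` Lipschitz with constant one for `∑ |x_i|` (`IsSubsolution.le_add_l1norm`).  With `q_k` the
columns of `A σ` and `a(x) = σᵗ x`, the trace in the equation is, up to an additive constant,
`∑ (∂²_{q_k} u + (a_k + ∂_{q_k} u)²)`, so that `w = exp u` satisfies a *linear* inequality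
`½ ∑ ∂²_{q_k} w + ∑ a_k ∂_{q_k} w ≥ c w`.  On a small ball the Lipschitz bound allows the first
order coefficients to be frozen (`IsSubsolution.touchesAbove_exp`).  What is left is an operator
`𝓛` with constant coefficients, and for such an operator a viscosity inequality `𝓛 w ≥ κ` is
inherited by mollifications of `w` (`le_genOp_mollify`).  Hence logarithms of mollifications of `exp u` are `C²`
approximate subsolutions, with the same bound on the gradient
(`IsSubsolution.exists_smooth_approx`).

*From viscosity to mollification.*  Let `T` be one step, of duration `h`, of a random walk whose
generator is close to `𝓛`.  If `g` is smooth and lies above `w`, then `w ≤ T^j g - j h κ + o(1)`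
as `h → 0`, by induction on `j`: at a maximum point of `w - T^(j+1) g` the smooth function
`T^(j+1) g` touches `w` from above, which bounds `𝓛 T^(j+1) g` from below (`le_walk_pow`).  Letting
`g` decrease to `w` and convolving with a mollifier, which commutes with `T`, gives
`ψ ≤ T^m ψ - t κ + o(t)` for the mollification `ψ` of `w` and `t = m h`; as `ψ` is smooth,
`T^m ψ = ψ + t 𝓛 ψ + O(t²)`, and `t → 0` yields `κ ≤ 𝓛 ψ`.  No Gaussian semigroup and no
differentiability theorem for semiconvex functions is needed, and `𝓛` may be degenerate.

*Comparison.*  For `τ < 1` and a smooth approximate subsolution `U`, the function `v - τ U` has a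
minimum by the growth conditions, and `τ U` is a test function for `v` there.  Its gradient does not
saturate the constraint, so the second order inequality holds for `τ U` with `mu`; compared with the
one for `U` it gives `τ lam - mu ≤ (1 - τ) K` with `K` independent of `τ`
(`exists_mul_sub_le`), the minimum point entering only through a term of favourable sign.
Then `τ → 1`.
-/

noncomputable section

namespace CorrectorEigenvalue

open scoped ContDiff
open MeasureTheory Metric

section ConstantCoefficients

variable {E : Type*} [NormedAddCommGroup E] [NormedSpace ℝ E]

/-! ### Directional derivatives and test functions -/

/-- The derivative of `φ` in the direction `q`. -/
def dirDeriv (q : E) (φ : E → ℝ) : E → ℝ := fun x => fderiv ℝ φ x q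

/-- Smooth functions of compact support. -/
structure IsTest (φ : E → ℝ) : Prop where
  smooth : ContDiff ℝ ∞ φ
  compact : HasCompactSupport φ

lemma IsTest.dirDeriv {φ : E → ℝ} (hφ : IsTest φ) (q : E) : IsTest (dirDeriv q φ) where
  smooth := (hφ.smooth.fderiv_right (m := ∞) (by simp)).clm_apply contDiff_const
  compact := hφ.compact.fderiv_apply ℝ q

lemma IsTest.add {φ ψ : E → ℝ} (hφ : IsTest φ) (hψ : IsTest ψ) : IsTest (φ + ψ) :=
  ⟨hφ.smooth.add hψ.smooth, hφ.compact.add hψ.compact⟩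

lemma IsTest.smul {φ : E → ℝ} (hφ : IsTest φ) (c : ℝ) : IsTest (c • φ) :=
  ⟨hφ.smooth.const_smul c, hφ.compact.comp_left (g := fun y : ℝ => c * y) (by simp)⟩

lemma IsTest.zero : IsTest (0 : E → ℝ) := ⟨contDiff_const, HasCompactSupport.zero⟩

lemma IsTest.sum {ι : Type*} (s : Finset ι) {φ : ι → E → ℝ} (h : ∀ i ∈ s, IsTest (φ i)) :
    IsTest (∑ i ∈ s, φ i) :=
  Finset.sum_induction φ IsTest (fun _ _ => IsTest.add) IsTest.zero h

lemma IsTest.translate {φ : E → ℝ} (hφ : IsTest φ) (d : E) : IsTest (fun x => φ (x + d)) where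
  smooth := hφ.smooth.comp (contDiff_id.add contDiff_const)
  compact := hφ.compact.comp_homeomorph (Homeomorph.addRight d)

lemma IsTest.differentiable {φ : E → ℝ} (hφ : IsTest φ) : Differentiable ℝ φ :=
  hφ.smooth.differentiable (by simp)

lemma IsTest.exists_bound {φ : E → ℝ} (hφ : IsTest φ) : ∃ C, 0 ≤ C ∧ ∀ x, |φ x| ≤ C := by
  obtain ⟨C, hC⟩ := hφ.smooth.continuous.bounded_above_of_compact_support hφ.compact
  exact ⟨C, (norm_nonneg _).trans (hC 0), hC⟩

lemma IsTest.exists_taylor_one {φ : E → ℝ} (hφ : IsTest φ) :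
    ∃ C, 0 ≤ C ∧ ∀ x d, |φ (x + d) - φ x - fderiv ℝ φ x d| ≤ C * ‖d‖ ^ 2 := by
  obtain ⟨K, hK⟩ := (hφ.smooth.fderiv_right (m := ∞) (by simp)).lipschitzWith_of_hasCompactSupport
    (hφ.compact.fderiv ℝ) (by simp)
  refine ⟨K, K.2, fun x d => ?_⟩
  have h := Convex.norm_image_sub_le_of_norm_fderiv_le' (𝕜 := ℝ) (f := φ) (C := K * ‖d‖)
    (s := closedBall x ‖d‖) (x := x) (y := x + d) (φ := fderiv ℝ φ x)
    (fun z _ => hφ.differentiable z) (fun z hz => ?_) (convex_closedBall _ _) (by simp) (by simp)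
  · simpa [mul_assoc, pow_two] using h
  · rw [← dist_eq_norm]
    exact (hK.dist_le_mul z x).trans (by gcongr; exact mem_closedBall.1 hz)

lemma IsTest.exists_lipschitz {φ : E → ℝ} (hφ : IsTest φ) :
    ∃ C, 0 ≤ C ∧ ∀ x d, |φ (x + d) - φ x| ≤ C * ‖d‖ := by
  obtain ⟨K, hK⟩ := hφ.smooth.lipschitzWith_of_hasCompactSupport hφ.compact (by simp)
  refine ⟨K, K.2, fun x d => ?_⟩
  simpa [Real.dist_eq] using hK.dist_le_mul (x + d) x

lemma hasDerivAt_line {φ : E → ℝ} (hφ : Differentiable ℝ φ) (x q : E) (s : ℝ) :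
    HasDerivAt (fun s : ℝ => φ (x + s • q)) (dirDeriv q φ (x + s • q)) s := by
  have h2 : HasDerivAt (fun s : ℝ => x + s • q) q s := by
    simpa using ((hasDerivAt_id s).smul_const q).const_add x
  exact (hφ (x + s • q)).hasFDerivAt.comp_hasDerivAt s h2

/-- Second order symmetric Taylor expansion with a remainder uniform in the base point. -/
lemma IsTest.exists_taylor_two {φ : E → ℝ} (hφ : IsTest φ) (q : E) :
    ∃ C, 0 ≤ C ∧ ∀ x, ∀ s : ℝ, 0 ≤ s → |φ (x + s • q) + φ (x - s • q) - 2 * φ x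
      - s ^ 2 * CorrectorEigenvalue.dirDeriv q (CorrectorEigenvalue.dirDeriv q φ) x|
        ≤ C * s ^ 3 := by
  obtain ⟨C, hC0, hC⟩ := (hφ.dirDeriv q).exists_taylor_one
  refine ⟨2 * C * ‖q‖ ^ 2, by positivity, fun x s hs => ?_⟩
  set χ := CorrectorEigenvalue.dirDeriv q φ with hχ
  have key : ∀ r : ℝ, |χ (x + r • q) - χ x - r * CorrectorEigenvalue.dirDeriv q χ x|
      ≤ C * ‖q‖ ^ 2 * r ^ 2 := by
    intro r
    have := hC x (r • q)
    rw [norm_smul, map_smul, mul_pow, Real.norm_eq_abs, sq_abs] at this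
    simpa [CorrectorEigenvalue.dirDeriv, mul_comm, mul_left_comm] using this
  have hder : ∀ r : ℝ, HasDerivAt (fun r : ℝ => φ (x + r • q) + φ (x - r • q) - 2 * φ x
      - r ^ 2 * CorrectorEigenvalue.dirDeriv q χ x)
      (χ (x + r • q) - χ (x + (-r) • q) - 2 * r * CorrectorEigenvalue.dirDeriv q χ x) r := by
    intro r
    have h1 := hasDerivAt_line hφ.differentiable x q r
    have h2 : HasDerivAt (fun r : ℝ => φ (x - r • q)) (-χ (x + (-r) • q)) r := by
      have := (hasDerivAt_line hφ.differentiable x q (-r)).comp r (hasDerivAt_neg r)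
      simpa [Function.comp_def, sub_eq_add_neg] using this
    have h3 := ((hasDerivAt_pow 2 r).mul_const (CorrectorEigenvalue.dirDeriv q χ x))
    refine (((h1.add h2).sub_const (2 * φ x)).sub h3).congr_deriv ?_
    simp [hχ, sub_eq_add_neg]
  have h := Convex.norm_image_sub_le_of_norm_hasDerivWithin_le (x := (0 : ℝ)) (y := s)
    (C := 2 * C * ‖q‖ ^ 2 * s ^ 2)
    (fun r _ => (hder r).hasDerivWithinAt (s := Set.Icc 0 s)) (fun r hr => ?_)
    (convex_Icc 0 s) ⟨le_rfl, hs⟩ ⟨hs, le_rfl⟩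
  · simp only [zero_smul, add_zero, sub_zero, Real.norm_eq_abs, abs_of_nonneg hs] at h
    calc _ ≤ _ := by
          convert h using 2
          ring
      _ = _ := by ring
  · have hr2 : r ^ 2 ≤ s ^ 2 := pow_le_pow_left₀ hr.1 hr.2 2
    have e1 := key r
    have e2 := key (-r)
    rw [abs_le] at e1 e2
    have h0 : C * ‖q‖ ^ 2 * r ^ 2 ≤ C * ‖q‖ ^ 2 * s ^ 2 := by gcongr
    rw [Real.norm_eq_abs, abs_le]
    constructor <;> nlinarith [e1.1, e1.2, e2.1, e2.2]

/-! ### The averaging operator -/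

section walk

variable {ι : Type*} [Fintype ι] (b : E) (q : ι → E)

/-- Translation `g ↦ g (· + d)` as a linear operator on functions. -/
def shift {G : Type*} [Add G] (d : G) : Module.End ℝ (G → ℝ) :=
  LinearMap.funLeft ℝ ℝ (fun x => x + d)

@[simp] lemma shift_apply {G : Type*} [Add G] (d : G) (g : G → ℝ) (x : G) :
    shift d g x = g (x + d) := rfl

/-- The constant coefficient operator `∂_b + (1/N) ∑ ½ ∂²_{q_k}`, with `N` the number of
directions `q_k`. -/
def genOp (φ : E → ℝ) : E → ℝ :=
  dirDeriv b φ + (Fintype.card ι : ℝ)⁻¹ • ∑ k, (2 : ℝ)⁻¹ • dirDeriv (q k) (dirDeriv (q k) φ)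

/-- One step, of duration `h`, of a random walk with generator close to `genOp b q`: the average
of `g` over the points `x + h b ± √h q_k`. -/
def walk (h : ℝ) : Module.End ℝ (E → ℝ) :=
  (Fintype.card ι : ℝ)⁻¹ • ∑ k, (2 : ℝ)⁻¹ •
    (shift (h • b + √h • q k) + shift (h • b - √h • q k))

lemma genOp_apply (φ : E → ℝ) (x : E) : genOp b q φ x = dirDeriv b φ x +
    (Fintype.card ι : ℝ)⁻¹ * ∑ k, (2 : ℝ)⁻¹ * dirDeriv (q k) (dirDeriv (q k) φ) x := by
  simp [genOp]

lemma walk_apply (h : ℝ) (g : E → ℝ) (x : E) : walk b q h g x = (Fintype.card ι : ℝ)⁻¹ *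
    ∑ k, (2 : ℝ)⁻¹ * (g (x + (h • b + √h • q k)) + g (x + (h • b - √h • q k))) := by
  simp [walk, mul_add]

variable {b q}

lemma IsTest.genOp {φ : E → ℝ} (hφ : IsTest φ) : IsTest (genOp b q φ) :=
  (hφ.dirDeriv b).add ((IsTest.sum _ fun _ _ => ((hφ.dirDeriv _).dirDeriv _).smul _).smul _)

lemma IsTest.walk {φ : E → ℝ} (hφ : IsTest φ) (h : ℝ) : IsTest (walk b q h φ) := by
  have : CorrectorEigenvalue.walk b q h φ = (Fintype.card ι : ℝ)⁻¹ • ∑ k, (2 : ℝ)⁻¹ •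
      ((fun x => φ (x + (h • b + √h • q k))) + (fun x => φ (x + (h • b - √h • q k)))) := by
    ext x; simp [walk_apply, mul_add]
  rw [this]
  exact (IsTest.sum _ fun _ _ => ((hφ.translate _).add (hφ.translate _)).smul _).smul _

lemma IsTest.walk_pow {φ : E → ℝ} (hφ : IsTest φ) (h : ℝ) (j : ℕ) :
    IsTest ((CorrectorEigenvalue.walk b q h ^ j) φ) := by
  induction j with
  | zero => simpa using hφ
  | succ j ih => rw [pow_succ', Module.End.mul_apply]; exact ih.walk h

lemma dirDeriv_walk {φ : E → ℝ} (hφ : IsTest φ) (p : E) (h : ℝ) :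
    dirDeriv p (walk b q h φ) = walk b q h (dirDeriv p φ) := by
  have e : walk b q h φ = fun x => (Fintype.card ι : ℝ)⁻¹ *
      ∑ k, (2 : ℝ)⁻¹ * (φ (x + (h • b + √h • q k)) + φ (x + (h • b - √h • q k))) := by
    ext x; rw [walk_apply]
  have hd : ∀ x d, HasFDerivAt (fun x => φ (x + d)) (fderiv ℝ φ (x + d)) x := fun x d => by
    simpa [fderiv_comp_add_right] using ((hφ.translate d).differentiable x).hasFDerivAt
  ext x
  rw [walk_apply, e, dirDeriv, HasFDerivAt.fderiv ((HasFDerivAt.fun_sum fun k _ =>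
    ((hd x (h • b + √h • q k)).fun_add (hd x (h • b - √h • q k))).const_mul (2 : ℝ)⁻¹).const_mul _)]
  simp [dirDeriv, mul_add]

lemma genOp_walk {φ : E → ℝ} (hφ : IsTest φ) (h : ℝ) :
    genOp b q (walk b q h φ) = walk b q h (genOp b q φ) := by
  simp only [genOp, map_add, map_smul, map_sum, dirDeriv_walk hφ, dirDeriv_walk (hφ.dirDeriv _)]

lemma genOp_walk_pow {φ : E → ℝ} (hφ : IsTest φ) (h : ℝ) (j : ℕ) :
    genOp b q ((walk b q h ^ j) φ) = (walk b q h ^ j) (genOp b q φ) := by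
  induction j with
  | zero => simp
  | succ j ih =>
    rw [pow_succ', Module.End.mul_apply, Module.End.mul_apply, genOp_walk (hφ.walk_pow h j), ih]

lemma walk_mono (h : ℝ) {f g : E → ℝ} (hfg : ∀ x, f x ≤ g x) (x : E) :
    walk b q h f x ≤ walk b q h g x := by
  rw [walk_apply, walk_apply]
  gcongr <;> apply hfg

lemma walk_pow_mono (h : ℝ) (j : ℕ) {f g : E → ℝ} (hfg : ∀ x, f x ≤ g x) (x : E) :
    (walk b q h ^ j) f x ≤ (walk b q h ^ j) g x := by
  induction j generalizing x with
  | zero => simpa using hfg x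
  | succ j ih => rw [pow_succ', Module.End.mul_apply, Module.End.mul_apply]; exact walk_mono h ih x

lemma continuous_walk {f : E → ℝ} (hf : Continuous f) (h : ℝ) : Continuous (walk b q h f) := by
  have : walk b q h f = fun x => (Fintype.card ι : ℝ)⁻¹ *
      ∑ k, (2 : ℝ)⁻¹ * (f (x + (h • b + √h • q k)) + f (x + (h • b - √h • q k))) := by
    ext x; rw [walk_apply]
  rw [this]
  fun_prop

lemma continuous_walk_pow {f : E → ℝ} (hf : Continuous f) (h : ℝ) (j : ℕ) :
    Continuous ((walk b q h ^ j) f) := by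
  induction j with
  | zero => simpa using hf
  | succ j ih => rw [pow_succ', Module.End.mul_apply]; exact continuous_walk ih h

variable [Nonempty ι]

lemma walk_const (h c : ℝ) : walk b q h (fun _ => c) = fun _ => c := by
  ext x
  rw [walk_apply]
  have : (Fintype.card ι : ℝ) ≠ 0 := by simp
  rw [← two_mul]
  simp [this]

lemma walk_pow_const (h c : ℝ) (j : ℕ) : (walk b q h ^ j) (fun _ => c) = fun _ => c := by
  induction j with
  | zero => simp
  | succ j ih => rw [pow_succ', Module.End.mul_apply, ih, walk_const]

lemma abs_walk_pow_le (h : ℝ) (j : ℕ) {f : E → ℝ} {C : ℝ} (hf : ∀ x, |f x| ≤ C) (x : E) :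
    |(walk b q h ^ j) f x| ≤ C := by
  rw [abs_le]
  constructor
  · simpa [walk_pow_const] using
      walk_pow_mono (b := b) (q := q) h j (f := fun _ => -C) (fun x => (abs_le.1 (hf x)).1) x
  · simpa [walk_pow_const] using
      walk_pow_mono (b := b) (q := q) h j (g := fun _ => C) (fun x => (abs_le.1 (hf x)).2) x

/-- The walk has generator `genOp b q`, uniformly in space. -/
lemma IsTest.exists_consistency {φ : E → ℝ} (hφ : IsTest φ) : ∃ C, 0 ≤ C ∧ ∀ h, 0 ≤ h → h ≤ 1 →
    ∀ x, |(CorrectorEigenvalue.walk b q h φ - φ - h • CorrectorEigenvalue.genOp b q φ) x|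
      ≤ C * (h * √h) := by
  have hN : (0 : ℝ) < Fintype.card ι := by simp [Fintype.card_pos]
  have hN1 : (Fintype.card ι : ℝ)⁻¹ ≤ 1 := inv_le_one_of_one_le₀ (by
    exact_mod_cast Fintype.card_pos)
  obtain ⟨C₁, hC₁0, hC₁⟩ := hφ.exists_taylor_one
  choose C₂ hC₂0 hC₂ using fun k => hφ.exists_taylor_two (q k)
  have hL : IsTest (CorrectorEigenvalue.genOp 0 q φ) := hφ.genOp
  obtain ⟨C₃, hC₃0, hC₃⟩ := hL.exists_lipschitz
  set L := CorrectorEigenvalue.genOp 0 q φ with hLdef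
  have hLx : ∀ x, L x = (Fintype.card ι : ℝ)⁻¹ * ∑ k, (2 : ℝ)⁻¹ *
      CorrectorEigenvalue.dirDeriv (q k) (CorrectorEigenvalue.dirDeriv (q k) φ) x := fun x => by
    rw [hLdef, genOp_apply]; simp [CorrectorEigenvalue.dirDeriv]
  refine ⟨∑ k, C₂ k + C₁ * ‖b‖ ^ 2 + C₃ * ‖b‖, by
    have := Finset.sum_nonneg fun k (_ : k ∈ Finset.univ) => hC₂0 k
    positivity, fun h h0 h1 x => ?_⟩
  have hsq : √h ^ 2 = h := Real.sq_sqrt h0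
  have hs1 : h ≤ √h := by
    have : √h ≤ 1 := Real.sqrt_le_one.2 h1
    nlinarith [Real.sqrt_nonneg h]
  have hhh : h * h ≤ h * √h := by gcongr
  have hs0 : 0 ≤ h * √h := by positivity
  set y := x + h • b with hy
  have e1 : |CorrectorEigenvalue.walk b q h φ x - φ y - h * L y| ≤ (∑ k, C₂ k) * (h * √h) := by
    have e : CorrectorEigenvalue.walk b q h φ x - φ y - h * L y = (Fintype.card ι : ℝ)⁻¹ *
        ∑ k, (2 : ℝ)⁻¹ * (φ (y + √h • q k) + φ (y - √h • q k) - 2 * φ y - √h ^ 2 *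
          CorrectorEigenvalue.dirDeriv (q k) (CorrectorEigenvalue.dirDeriv (q k) φ) y) := by
      have e0 : φ y = (Fintype.card ι : ℝ)⁻¹ * ∑ k : ι, φ y := by
        simp [hN.ne']
      rw [walk_apply, hLx, e0, mul_left_comm, ← mul_sub, Finset.mul_sum, ← Finset.sum_sub_distrib,
        ← mul_sub, ← Finset.sum_sub_distrib, ← e0]
      congr 1
      refine Finset.sum_congr rfl fun k _ => ?_
      rw [hsq, hy, add_assoc, add_sub_assoc x (h • b)]
      ring
    rw [e, abs_mul, abs_of_nonneg (inv_nonneg.2 hN.le), Finset.sum_mul]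
    refine (mul_le_of_le_one_left (abs_nonneg _) hN1).trans
      ((Finset.abs_sum_le_sum_abs _ _).trans (Finset.sum_le_sum fun k _ => ?_))
    rw [abs_mul]
    have hk := hC₂ k y (√h) (Real.sqrt_nonneg h)
    have : √h ^ 3 = h * √h := by rw [pow_succ, hsq]
    rw [this] at hk
    rw [abs_of_pos (by norm_num : (0 : ℝ) < 2⁻¹)]
    linarith [abs_nonneg (φ (y + √h • q k) + φ (y - √h • q k) - 2 * φ y - √h ^ 2 *
          CorrectorEigenvalue.dirDeriv (q k) (CorrectorEigenvalue.dirDeriv (q k) φ) y)]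
  have e2 : |φ y - φ x - h * CorrectorEigenvalue.dirDeriv b φ x| ≤ C₁ * ‖b‖ ^ 2 * (h * √h) := by
    have := hC₁ x (h • b)
    rw [map_smul, norm_smul, mul_pow, Real.norm_eq_abs, sq_abs, smul_eq_mul] at this
    refine this.trans ?_
    rw [mul_comm (h ^ 2), ← mul_assoc, pow_two h]
    gcongr
  have e3 : |h * (L y - L x)| ≤ C₃ * ‖b‖ * (h * √h) := by
    have := hC₃ x (h • b)
    rw [norm_smul, Real.norm_eq_abs, abs_of_nonneg h0] at this
    rw [abs_mul, abs_of_nonneg h0]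
    calc h * |L y - L x| ≤ h * (C₃ * (h * ‖b‖)) := by gcongr
      _ = C₃ * ‖b‖ * (h * h) := by ring
      _ ≤ _ := by gcongr
  have e4 : CorrectorEigenvalue.genOp b q φ x = CorrectorEigenvalue.dirDeriv b φ x + L x := by
    rw [genOp_apply, hLx]
  simp only [Pi.sub_apply, Pi.smul_apply, smul_eq_mul, e4]
  rw [abs_le] at *
  constructor <;> linarith [e1.1, e1.2, e2.1, e2.2, e3.1, e3.2]

end walk

section iterates

variable {ι : Type*} [Fintype ι] {b : E} {q : ι → E} [Nonempty ι]

lemma IsTest.exists_walk_sub_le {φ : E → ℝ} (hφ : IsTest φ) : ∃ C, 0 ≤ C ∧ ∀ h, 0 ≤ h → h ≤ 1 →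
    ∀ x, |(CorrectorEigenvalue.walk b q h φ - φ) x| ≤ C * h := by
  obtain ⟨C, hC0, hC⟩ := hφ.exists_consistency (b := b) (q := q)
  obtain ⟨D, hD0, hD⟩ := (hφ.genOp (b := b) (q := q)).exists_bound
  refine ⟨C + D, by positivity, fun h h0 h1 x => ?_⟩
  have e1 := hC h h0 h1 x
  have e2 := hD x
  have : C * (h * √h) ≤ C * h := by
    have : √h ≤ 1 := Real.sqrt_le_one.2 h1
    gcongr
    exact mul_le_of_le_one_right h0 this
  simp only [Pi.sub_apply, Pi.smul_apply, smul_eq_mul] at e1 ⊢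
  rw [abs_le] at *
  constructor <;> nlinarith [e1.1, e1.2, e2.1, e2.2]

lemma IsTest.exists_walk_pow_sub_le {φ : E → ℝ} (hφ : IsTest φ) :
    ∃ C, 0 ≤ C ∧ ∀ h, 0 ≤ h → h ≤ 1 → ∀ j : ℕ, ∀ x,
      |((CorrectorEigenvalue.walk b q h ^ j) φ - φ) x| ≤ C * (j * h) := by
  obtain ⟨C, hC0, hC⟩ := hφ.exists_walk_sub_le (b := b) (q := q)
  refine ⟨C, hC0, fun h h0 h1 j => ?_⟩
  induction j with
  | zero => intro x; simp
  | succ j ih =>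
    intro x
    have e1 := abs_walk_pow_le (b := b) (q := q) h j (hC h h0 h1) x
    have e2 := ih x
    rw [map_sub, ← Module.End.mul_apply, ← pow_succ] at e1
    simp only [Pi.sub_apply] at *
    push_cast
    rw [abs_le] at *
    constructor <;> linarith [e1.1, e1.2, e2.1, e2.2]

/-- One further step of the walk is an Euler step for `genOp b q`, with an error uniform in the
number of previous steps: all the operators commute and the walk is a contraction. -/
lemma IsTest.exists_walk_step {φ : E → ℝ} (hφ : IsTest φ) : ∃ C, 0 ≤ C ∧ ∀ h, 0 ≤ h → h ≤ 1 →
    ∀ j : ℕ, ∀ x, |((CorrectorEigenvalue.walk b q h ^ (j + 1)) φ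
      - (CorrectorEigenvalue.walk b q h ^ j) φ
      - h • CorrectorEigenvalue.genOp b q ((CorrectorEigenvalue.walk b q h ^ (j + 1)) φ)) x|
        ≤ C * (h * √h) := by
  obtain ⟨C, hC0, hC⟩ := hφ.exists_consistency (b := b) (q := q)
  obtain ⟨D, hD0, hD⟩ := (hφ.genOp (b := b) (q := q)).exists_walk_sub_le (b := b) (q := q)
  refine ⟨C + D, by positivity, fun h h0 h1 j x => ?_⟩
  have hs1 : h ≤ √h := by
    have : √h ≤ 1 := Real.sqrt_le_one.2 h1
    nlinarith [Real.sqrt_nonneg h, Real.sq_sqrt h0]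
  have e1 := abs_walk_pow_le (b := b) (q := q) h j (hC h h0 h1) x
  have e2 := abs_walk_pow_le (b := b) (q := q) h j (hD h h0 h1) x
  rw [genOp_walk_pow hφ, pow_succ, Module.End.mul_apply, Module.End.mul_apply]
  simp only [map_sub, map_smul, Pi.sub_apply, Pi.smul_apply, smul_eq_mul] at *
  have e3 : D * (h * h) ≤ D * (h * √h) := by gcongr
  rw [abs_le] at *
  constructor <;> nlinarith [e1.1, e1.2, e2.1, e2.2]

/-- Short time expansion of the walk: `T^j φ = φ + t 𝓛φ + O(t²)` for `t = j h`, up to an error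
vanishing with the step size. -/
lemma IsTest.exists_walk_pow_expansion {φ : E → ℝ} (hφ : IsTest φ) :
    ∃ C, 0 ≤ C ∧ ∀ h, 0 ≤ h → h ≤ 1 → ∀ j : ℕ, ∀ x,
      |((CorrectorEigenvalue.walk b q h ^ j) φ - φ
        - (j * h) • CorrectorEigenvalue.genOp b q φ) x| ≤ C * (j * h * √h + (j * h) ^ 2) := by
  obtain ⟨C, hC0, hC⟩ := hφ.exists_walk_step (b := b) (q := q)
  obtain ⟨D, hD0, hD⟩ := (hφ.genOp (b := b) (q := q)).exists_walk_pow_sub_le (b := b) (q := q)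
  refine ⟨C + D, by positivity, fun h h0 h1 j => ?_⟩
  have main : ∀ i ≤ j, ∀ x, |((CorrectorEigenvalue.walk b q h ^ i) φ - φ
        - (i * h) • CorrectorEigenvalue.genOp b q φ) x|
        ≤ i * (C * (h * √h) + D * (h * (j * h))) := by
    intro i
    induction i with
    | zero => intro _ x; simp
    | succ i ih =>
      intro hi x
      have e1 := hC h h0 h1 i x
      have e2 := hD h h0 h1 (i + 1) x
      have e3 := ih (by omega) x
      rw [genOp_walk_pow hφ] at e1
      simp only [Pi.sub_apply, Pi.smul_apply, smul_eq_mul] at *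
      have e4 : D * (((i + 1 : ℕ) : ℝ) * h) ≤ D * (j * h) := by gcongr
      have e5 := mul_le_mul_of_nonneg_left (e2.trans e4) h0
      rw [← abs_of_nonneg h0, ← abs_mul, abs_of_nonneg h0] at e5
      push_cast at *
      rw [abs_le] at *
      constructor <;> linarith [e1.1, e1.2, e3.1, e3.2, e5.1, e5.2]
  intro x
  refine (main j le_rfl x).trans ?_
  have : 0 ≤ D * (j * h * √h) := by positivity
  have : 0 ≤ C * (j * h) ^ 2 := by positivity
  nlinarith

end iterates

variable {ι : Type*} [Fintype ι] {b : E} {q : ι → E}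

/-! ### Comparison of a viscosity subsolution with the walk -/

/-- The inequality `genOp b q w ≥ κ` holds at `x` in the viscosity sense.  Test functions touch `w`
from above up to an additive constant, and only smooth ones are used. -/
def TouchesAbove (b : E) (q : ι → E) (κ : ℝ) (w : E → ℝ) (x : E) : Prop :=
  ∀ φ : E → ℝ, ContDiff ℝ ∞ φ → IsLocalMax (fun y => w y - φ y) x → κ ≤ genOp b q φ x

/-- Implicit time stepping: wherever `w - T^(j+1) g` is maximal, the function `T^(j+1) g` touches
`w` from above, which bounds `𝓛 T^(j+1) g` from below there. -/
lemma le_walk_pow [FiniteDimensional ℝ E] {w g : E → ℝ} {x₀ : E} {R R' κ h ε : ℝ} {m : ℕ}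
    (hR : 0 ≤ R) (hRR : R' < R)
    (hw : Continuous w) (hg : IsTest g)
    (hvisc : ∀ x ∈ ball x₀ R, TouchesAbove b q κ w x)
    (hstep : ∀ j : ℕ, ∀ x, |((walk b q h ^ (j + 1)) g - (walk b q h ^ j) g
      - h • genOp b q ((walk b q h ^ (j + 1)) g)) x| ≤ h * ε)
    (h0 : 0 ≤ h) (hε : 0 ≤ ε)
    (hle : ∀ x ∈ closedBall x₀ R, w x ≤ g x)
    (hfar : ∀ j ≤ m, ∀ x ∈ closedBall x₀ R, R' ≤ dist x x₀ →
      w x ≤ (walk b q h ^ j) g x - j * h * κ) {j : ℕ} (hj : j ≤ m) {x : E}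
    (hx : x ∈ closedBall x₀ R) :
    w x ≤ (walk b q h ^ j) g x - j * h * κ + j * h * ε := by
  induction j generalizing x with
  | zero => simpa using hle x hx
  | succ j ih =>
    have hsm := (hg.walk_pow (b := b) (q := q) h (j + 1)).smooth
    obtain ⟨z, hz, hmax⟩ := (isCompact_closedBall x₀ R).exists_isMaxOn
      ⟨x₀, mem_closedBall_self hR⟩ (hw.sub hsm.continuous).continuousOn
    have hxz : w x - (walk b q h ^ (j + 1)) g x ≤ w z - (walk b q h ^ (j + 1)) g z := hmax hx
    suffices hzz : w z ≤ (walk b q h ^ (j + 1)) g z - (j + 1 : ℕ) * h * κ + (j + 1 : ℕ) * h * ε by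
      linarith
    by_cases hzR : R' ≤ dist z x₀
    · have : 0 ≤ ((j + 1 : ℕ) : ℝ) * h * ε := by positivity
      linarith [hfar (j + 1) hj z hz hzR]
    · have hzb : z ∈ ball x₀ R := by rw [mem_ball]; linarith
      have hloc : IsLocalMax (fun y => w y - (walk b q h ^ (j + 1)) g y) z :=
        hmax.isLocalMax (mem_of_superset (isOpen_ball.mem_nhds hzb) ball_subset_closedBall)
      have h1 := hvisc z hzb _ hsm hloc
      have h2 := ih (by omega) hz
      have h3 := (abs_le.1 (hstep j z)).1
      have h4 := mul_le_mul_of_nonneg_left h1 h0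
      simp only [Pi.sub_apply, Pi.smul_apply, smul_eq_mul] at h3
      push_cast
      linarith

lemma dirDeriv_congr {f g : E → ℝ} {x p : E} (h : f =ᶠ[𝓝 x] g) :
    dirDeriv p f =ᶠ[𝓝 x] dirDeriv p g :=
  (h.fderiv (𝕜 := ℝ)).mono fun y hy => by simp [dirDeriv, hy]

lemma genOp_congr {f g : E → ℝ} {x : E} {c : ℝ} (h : f =ᶠ[𝓝 x] fun y => g y + c) :
    genOp b q f x = genOp b q g x := by
  have h1 : ∀ p, dirDeriv p f =ᶠ[𝓝 x] dirDeriv p g := fun p =>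
    (dirDeriv_congr h).trans (Eventually.of_forall fun y => by simp [dirDeriv])
  simp only [genOp_apply, (h1 b).eq_of_nhds, (dirDeriv_congr (h1 _)).eq_of_nhds]

/-! ### Mollification -/

section mollify

variable [FiniteDimensional ℝ E] [MeasureSpace E]

/-- The convolution of `f` with the bump `ζ`, normalised to have integral one. -/
def mollify (ζ : ContDiffBump (0 : E)) (f : E → ℝ) : E → ℝ :=
  convolution (ζ.normed volume) f (ContinuousLinearMap.lsmul ℝ ℝ) volume

variable (ζ : ContDiffBump (0 : E))

lemma mollify_apply (f : E → ℝ) (x : E) :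
    mollify ζ f x = ∫ t, ζ.normed volume t * f (x - t) := by
  simp [mollify, convolution]

variable [BorelSpace E] [(volume : Measure E).IsAddHaarMeasure]

lemma integrable_mollify {f : E → ℝ} (hf : Continuous f) (x : E) :
    Integrable fun t => ζ.normed volume t * f (x - t) := by
  refine Continuous.integrable_of_hasCompactSupport
    (ζ.continuous_normed.mul (hf.comp (continuous_const.sub continuous_id))) ?_
  exact ζ.hasCompactSupport_normed.mul_right

lemma contDiff_mollify {f : E → ℝ} (hf : Continuous f) : ContDiff ℝ ∞ (mollify ζ f) :=
  ζ.hasCompactSupport_normed.contDiff_convolution_left _ ζ.contDiff_normed hf.locallyIntegrable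

lemma isTest_mollify {f : E → ℝ} (hf : Continuous f) (hc : HasCompactSupport f) :
    IsTest (mollify ζ f) :=
  ⟨contDiff_mollify ζ hf, ζ.hasCompactSupport_normed.convolution _ hc⟩

lemma mollify_le_add {f g : E → ℝ} (hf : Continuous f) (hg : Continuous g) {x : E} {c : ℝ}
    (h : ∀ y ∈ ball x ζ.rOut, f y ≤ g y + c) : mollify ζ f x ≤ mollify ζ g x + c := by
  have e : mollify ζ g x + c = ∫ t, (ζ.normed volume t * g (x - t) + ζ.normed volume t * c) := by
    rw [integral_add (integrable_mollify ζ hg x) (ζ.integrable_normed.mul_const c),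
      integral_mul_const, ζ.integral_normed, one_mul, mollify_apply]
  rw [e, mollify_apply]
  refine integral_mono (integrable_mollify ζ hf x)
    ((integrable_mollify ζ hg x).add (ζ.integrable_normed.mul_const c)) fun t => ?_
  by_cases ht : t ∈ ball (0 : E) ζ.rOut
  · have := h (x - t) (by simpa [mem_ball, dist_eq_norm] using ht)
    simp only [← mul_add]
    exact mul_le_mul_of_nonneg_left this (ζ.nonneg_normed t)
  · have : ζ.normed volume t = 0 := by
      rw [← Function.notMem_support, ζ.support_normed_eq]; exact ht
    simp [this]

lemma mollify_const (c : ℝ) (x : E) : mollify ζ (fun _ => c) x = c := by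
  rw [mollify_apply, integral_mul_const, ζ.integral_normed, one_mul]

lemma mollify_walk {f : E → ℝ} (hf : Continuous f) (h : ℝ) :
    mollify ζ (walk b q h f) = walk b q h (mollify ζ f) := by
  ext x
  have e : ∀ t d : E, x - t + d = x + d - t := fun t d => by abel
  have hi := fun d : E => integrable_mollify ζ hf (x + d)
  rw [walk_apply, mollify_apply]
  simp only [walk_apply, mollify_apply, e, Finset.mul_sum, mul_add]
  rw [integral_finsetSum]
  · refine Finset.sum_congr rfl fun k _ => ?_
    rw [← integral_const_mul, ← integral_const_mul, ← integral_const_mul, ← integral_const_mul,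
      ← integral_add]
    · congr 1; ext t; ring
    · exact ((hi _).const_mul _).const_mul _
    · exact ((hi _).const_mul _).const_mul _
  · intro k _
    convert (((hi (h • b + √h • q k)).add (hi (h • b - √h • q k))).const_mul
      ((Fintype.card ι : ℝ)⁻¹ * 2⁻¹)) using 1
    ext t; simp; ring

lemma mollify_walk_pow {f : E → ℝ} (hf : Continuous f) (h : ℝ) (j : ℕ) :
    mollify ζ ((walk b q h ^ j) f) = (walk b q h ^ j) (mollify ζ f) := by
  induction j with
  | zero => simp
  | succ j ih =>
    rw [pow_succ', Module.End.mul_apply, Module.End.mul_apply,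
      mollify_walk ζ (continuous_walk_pow hf h j), ih]

lemma exists_isTest_near {f : E → ℝ} (hf : Continuous f) (hc : HasCompactSupport f) {δ : ℝ}
    (hδ : 0 < δ) : ∃ g, IsTest g ∧ ∀ x, |g x - f x| ≤ δ := by
  obtain ⟨r, hr, hfr⟩ := Metric.uniformContinuous_iff.1 (hc.uniformContinuous_of_continuous hf) δ hδ
  let ζ : ContDiffBump (0 : E) := ⟨r / 2, r, by positivity, by linarith⟩
  refine ⟨mollify ζ f, isTest_mollify ζ hf hc, fun x => ?_⟩
  rw [← Real.dist_eq]
  exact ContDiffBump.dist_normed_convolution_le hf.aestronglyMeasurable fun y hy =>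
    (hfr (by simpa using hy)).le

/-- A viscosity inequality `𝓛w ≥ κ` passes to mollifications.  The comparison with the walk gives
`w ≤ T^m w - t κ` up to errors negligible against `t = m h`; mollification commutes with the walk,
and the mollified function, being smooth, satisfies `T^m ψ = ψ + t 𝓛ψ + O(t²)`. -/
theorem le_genOp_mollify [Nonempty ι] {w : E → ℝ} (hw : Continuous w) {x₀ : E} {R κ : ℝ}
    (hR : 0 < R) (hvisc : ∀ x ∈ ball x₀ R, TouchesAbove b q κ w x) (hζ : ζ.rOut ≤ R / 4) :
    κ ≤ genOp b q (mollify ζ w) x₀ := by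
  obtain ⟨K, hK⟩ : ∃ K, ∀ x ∈ closedBall x₀ R, w x ≤ K := by
    obtain ⟨K, hK⟩ := (isCompact_closedBall x₀ R).exists_bound_of_continuousOn hw.continuousOn
    exact ⟨K, fun x hx => (le_abs_self _).trans (hK x hx)⟩
  -- cutting off a function `≤ -1` only increases it, and lifts it by one near the boundary
  let χ : ContDiffBump x₀ := ⟨R / 2, 3 * R / 4, by positivity, by linarith⟩
  set G : E → ℝ := fun x => χ x * (w x - K - 1) with hG
  have hGc : Continuous G := χ.continuous.mul (by fun_prop)
  have hGs : HasCompactSupport G := χ.hasCompactSupport.mul_right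
  have hG1 : ∀ x ∈ ball x₀ (R / 2), G x = w x - K - 1 := fun x hx => by
    simp [hG, χ.one_of_mem_closedBall (ball_subset_closedBall hx)]
  have hG2 : ∀ x ∈ closedBall x₀ R, w x - K - 1 ≤ G x := fun x hx => by
    have h1 := hK x hx
    have h2 := χ.le_one (x := x)
    have h3 := χ.nonneg (x := x)
    simp only [hG]
    nlinarith
  have hG3 : ∀ x, 3 * R / 4 ≤ dist x x₀ → G x = 0 := fun x hx => by
    simp [hG, χ.zero_of_le_dist hx]
  set ψ := mollify ζ G with hψ
  have hψt : IsTest ψ := isTest_mollify ζ hGc hGs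
  have hψw : genOp b q (mollify ζ w) x₀ = genOp b q ψ x₀ := by
    refine (genOp_congr (c := -(K + 1)) ?_).symm
    filter_upwards [ball_mem_nhds x₀ (by positivity : 0 < R / 4)] with x hx
    have hsub : ∀ y ∈ ball x ζ.rOut, G y = w y - K - 1 := fun y hy => hG1 y <| by
      rw [mem_ball] at *
      linarith [dist_triangle y x x₀]
    have h1 : mollify ζ G x ≤ mollify ζ w x + -(K + 1) :=
      mollify_le_add ζ hGc hw fun y hy => by rw [hsub y hy]; linarith
    have h2 : mollify ζ w x ≤ mollify ζ G x + (K + 1) :=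
      mollify_le_add ζ hw hGc fun y hy => by rw [hsub y hy]; linarith
    linarith
  rw [hψw]
  -- `g₁` bounds the motion of the walk away from `G` for all approximations of `G` at once
  obtain ⟨g₁, hg₁, hg₁G⟩ := exists_isTest_near hGc hGs (by norm_num : (0 : ℝ) < 1 / 4)
  obtain ⟨C₁, hC₁0, hC₁⟩ := hg₁.exists_walk_pow_sub_le (b := b) (q := q)
  obtain ⟨C₂, hC₂0, hC₂⟩ := hψt.exists_walk_pow_expansion (b := b) (q := q)
  -- the estimate for a fixed time `t`, in the limit of vanishing step size
  have main : ∀ t, 0 < t → t ≤ 1 → t * (C₁ + |κ|) ≤ 1 / 2 →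
      κ ≤ genOp b q ψ x₀ + (C₂ + 2) * t := by
    intro t ht ht1 htC
    -- an approximation within `t ^ 2` is negligible after division by `t`
    obtain ⟨g, hg, hgG⟩ := exists_isTest_near hGc hGs (by positivity : 0 < t ^ 2)
    obtain ⟨C₃, hC₃0, hC₃⟩ := hg.exists_walk_step (b := b) (q := q)
    have step : ∀ m : ℕ, κ ≤ genOp b q ψ x₀ + (C₂ + 2) * t + (C₂ + C₃) * √(t / (m + 1 : ℕ)) := by
      intro m
      set h := t / (m + 1 : ℕ) with hh
      have hm : (0 : ℝ) < (m + 1 : ℕ) := by positivity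
      have h0 : 0 ≤ h := by positivity
      have hmh : ((m + 1 : ℕ) : ℝ) * h = t := by rw [hh]; field_simp
      have h1 : h ≤ 1 := (div_le_self ht.le (by simp)).trans ht1
      have hcmp : ∀ x ∈ ball x₀ (R / 2), G x ≤ (walk b q h ^ (m + 1)) G x
          + (2 * t ^ 2 - t * κ + t * (C₃ * √h)) := by
        intro x hx
        have hx' : x ∈ closedBall x₀ R := by
          rw [mem_ball] at hx; rw [mem_closedBall]; linarith
        have := le_walk_pow (b := b) (q := q) (w := fun x => w x - K - 1 - t ^ 2) (g := g) (κ := κ)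
          (h := h) (ε := C₃ * √h) (m := m + 1) (R' := 3 * R / 4) hR.le (by linarith)
          (by fun_prop) hg
          (fun y hy φ hφ hmax => hvisc y hy φ hφ (by
            refine hmax.mono fun z hz => ?_
            linarith))
          (fun j y => (hC₃ h h0 h1 j y).trans (by rw [mul_left_comm]))
          h0 (by positivity)
          (fun y hy => by linarith [hG2 y hy, (abs_le.1 (hgG y)).1])
          (fun j hj y hy hyR => by
            have a1 := hK y hy
            have a2 := hG3 y hyR
            have a3 := (abs_le.1 (hC₁ h h0 h1 j y)).1
            have a4 := (abs_le.1 (hg₁G y)).1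
            have a5 := (abs_le.1 (abs_walk_pow_le (b := b) (q := q) h j
              (f := g₁ - G) (fun z => by simpa using hg₁G z) y)).2
            have a6 := (abs_le.1 (abs_walk_pow_le (b := b) (q := q) h j
              (f := g - G) (fun z => by simpa using hgG z) y)).1
            have a7 : (j : ℝ) * h ≤ t := by rw [← hmh]; gcongr
            have a8 : (j : ℝ) * h * (C₁ + |κ|) ≤ 1 / 2 := le_trans (by gcongr) htC
            have a9 : (j : ℝ) * h * κ ≤ j * h * |κ| := by gcongr; exact le_abs_self κ
            simp only [map_sub, Pi.sub_apply] at a3 a5 a6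
            linarith)
          (j := m + 1) le_rfl hx'
        rw [hmh] at this
        have b1 := (abs_le.1 (abs_walk_pow_le (b := b) (q := q) h (m + 1)
              (f := g - G) (fun z => by simpa using hgG z) x)).2
        simp only [map_sub, Pi.sub_apply] at b1
        linarith [hG1 x hx]
      have hmol := mollify_le_add ζ (x := x₀) hGc
        (continuous_walk_pow (b := b) (q := q) hGc h (m + 1))
        (fun y hy => hcmp y (by rw [mem_ball] at *; linarith))
      rw [mollify_walk_pow ζ hGc, ← hψ] at hmol
      have hexp := (abs_le.1 (hC₂ h h0 h1 (m + 1) x₀)).2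
      simp only [Pi.sub_apply, Pi.smul_apply, smul_eq_mul] at hexp
      rw [hmh] at hexp
      have : t * κ ≤ t * (genOp b q ψ x₀ + (C₂ + 2) * t + (C₂ + C₃) * √h) := by linarith
      exact le_of_mul_le_mul_left this ht
    have hlim : Tendsto (fun m : ℕ => genOp b q ψ x₀ + (C₂ + 2) * t
        + (C₂ + C₃) * √(t / (m + 1 : ℕ))) atTop
        (𝓝 (genOp b q ψ x₀ + (C₂ + 2) * t + (C₂ + C₃) * √0)) := by
      refine tendsto_const_nhds.add (tendsto_const_nhds.mul (Tendsto.sqrt ?_))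
      exact (tendsto_const_div_atTop_nhds_zero_nat t).comp (tendsto_add_atTop_nat 1)
    simpa using ge_of_tendsto' hlim step
  have hlim : Tendsto (fun t : ℝ => genOp b q ψ x₀ + (C₂ + 2) * t) (𝓝[>] 0)
      (𝓝 (genOp b q ψ x₀ + (C₂ + 2) * 0)) :=
    (Continuous.tendsto (by fun_prop) 0).mono_left nhdsWithin_le_nhds
  rw [mul_zero, add_zero] at hlim
  refine ge_of_tendsto hlim ?_
  have hsmall : ∀ᶠ t : ℝ in 𝓝[>] 0, t * (C₁ + |κ|) < 1 / 2 :=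
    (((Continuous.tendsto (by fun_prop : Continuous fun t : ℝ => t * (C₁ + |κ|)) 0).mono_left
      nhdsWithin_le_nhds).eventually (gt_mem_nhds (by norm_num)))
  filter_upwards [hsmall, Ioc_mem_nhdsGT (zero_lt_one' ℝ)] with t h1 h2
  exact main t h2.1 h2.2 h1.le

end mollify

end ConstantCoefficients

variable {n : ℕ}

/-! ### Growth at infinity and the Lipschitz bound -/

/-- The norm `∑ |x_i|` on `ℝⁿ`. -/
def l1norm (x : EuclideanSpace ℝ (Fin n)) : ℝ := ∑ i, |x i|

lemma l1norm_nonneg (x : EuclideanSpace ℝ (Fin n)) : 0 ≤ l1norm x :=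
  Finset.sum_nonneg fun _ _ => abs_nonneg _

lemma abs_apply_le_l1norm (x : EuclideanSpace ℝ (Fin n)) (i : Fin n) : |x i| ≤ l1norm x :=
  Finset.single_le_sum (f := fun i => |x i|) (fun _ _ => abs_nonneg _) (Finset.mem_univ i)

lemma l1norm_le (x : EuclideanSpace ℝ (Fin n)) : l1norm x ≤ n * ‖x‖ := by
  have := Finset.sum_le_card_nsmul Finset.univ (fun i => |x i|) ‖x‖
    (fun i _ => PiLp.norm_apply_le x i)
  simpa [l1norm] using this

lemma norm_le_l1norm (x : EuclideanSpace ℝ (Fin n)) : ‖x‖ ≤ l1norm x := by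
  rw [EuclideanSpace.norm_eq]
  refine Real.sqrt_le_iff.2 ⟨l1norm_nonneg x, ?_⟩
  calc ∑ i, ‖x i‖ ^ 2 = ∑ i, |x i| * |x i| := by simp [pow_two]
    _ ≤ ∑ i, |x i| * l1norm x := by
        gcongr with i; exact abs_apply_le_l1norm x i
    _ = l1norm x ^ 2 := by rw [← Finset.sum_mul, pow_two, l1norm]

lemma l1norm_add_le (x y : EuclideanSpace ℝ (Fin n)) : l1norm (x + y) ≤ l1norm x + l1norm y := by
  rw [l1norm, l1norm, l1norm, ← Finset.sum_add_distrib]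
  exact Finset.sum_le_sum fun i _ => abs_add_le _ _

lemma l1norm_neg (x : EuclideanSpace ℝ (Fin n)) : l1norm (-x) = l1norm x := by
  simp [l1norm]

lemma exists_le_mul_l1norm {u : EuclideanSpace ℝ (Fin n) → ℝ}
    (hu : limsup (fun x => ((growthRatio u x : ℝ) : EReal))
      (Bornology.cobounded (EuclideanSpace ℝ (Fin n))) ≤ 1) {C : ℝ} (hC : 1 < C) :
    ∃ R, ∀ x, R ≤ ‖x‖ → u x ≤ C * l1norm x := by
  have hlt : limsup (fun x => ((growthRatio u x : ℝ) : EReal))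
      (Bornology.cobounded (EuclideanSpace ℝ (Fin n))) < (C : EReal) :=
    hu.trans_lt (by exact_mod_cast hC)
  obtain ⟨R, -, hR⟩ := hasBasis_cobounded_norm.eventually_iff.1
    (eventually_lt_of_limsup_lt hlt)
  refine ⟨max R 1, fun x hx => ?_⟩
  have h1 : growthRatio u x < C := by exact_mod_cast hR ((le_max_left _ _).trans hx)
  have h2 : 0 < l1norm x :=
    lt_of_lt_of_le zero_lt_one (((le_max_right _ _).trans hx).trans (norm_le_l1norm x))
  exact ((div_lt_iff₀ h2).1 h1).le

lemma exists_mul_l1norm_le {v : EuclideanSpace ℝ (Fin n) → ℝ}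
    (hv : 1 ≤ liminf (fun x => ((growthRatio v x : ℝ) : EReal))
      (Bornology.cobounded (EuclideanSpace ℝ (Fin n)))) {C : ℝ} (hC : C < 1) :
    ∃ R, ∀ x, R ≤ ‖x‖ → C * l1norm x ≤ v x := by
  have hlt : (C : EReal) < liminf (fun x => ((growthRatio v x : ℝ) : EReal))
      (Bornology.cobounded (EuclideanSpace ℝ (Fin n))) :=
    lt_of_lt_of_le (by exact_mod_cast hC) hv
  obtain ⟨R, -, hR⟩ := hasBasis_cobounded_norm.eventually_iff.1
    (eventually_lt_of_lt_liminf hlt)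
  refine ⟨max R 1, fun x hx => ?_⟩
  have h1 : C < growthRatio v x := by exact_mod_cast hR ((le_max_left _ _).trans hx)
  have h2 : 0 < l1norm x :=
    lt_of_lt_of_le zero_lt_one (((le_max_right _ _).trans hx).trans (norm_le_l1norm x))
  exact ((lt_div_iff₀ h2).1 h1).le

lemma exists_forall_le_of_coercive {f : EuclideanSpace ℝ (Fin n) → ℝ}
    (hf : UpperSemicontinuous f) {R : ℝ} {z : EuclideanSpace ℝ (Fin n)}
    (h : ∀ y, R < ‖y‖ → f y ≤ f z) : ∃ y, ∀ y', f y' ≤ f y := by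
  obtain ⟨y, -, hy⟩ := (hf.upperSemicontinuousOn _).exists_isMaxOn
    (s := closedBall 0 (max R ‖z‖)) ⟨z, by simp⟩ (isCompact_closedBall _ _)
  refine ⟨y, fun y' => ?_⟩
  by_cases hy' : ‖y'‖ ≤ max R ‖z‖
  · exact hy (by simpa using hy')
  · exact (h y' ((le_max_left _ _).trans_lt (not_le.1 hy'))).trans (hy (by simp))

lemma IsSubsolution.abs_partialDeriv_le {σ A : Matrix (Fin n) (Fin n) ℝ} {lam : ℝ}
    {u φ : EuclideanSpace ℝ (Fin n) → ℝ} {x : EuclideanSpace ℝ (Fin n)}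
    (hu : IsSubsolution σ A lam u) (hφ : ContDiff ℝ 2 φ)
    (hmax : IsLocalMax (fun y => u y - φ y) x) (i : Fin n) : |partialDeriv i φ x| ≤ 1 := by
  have h := (max_le_iff.1 (hu.2 x φ hφ hmax)).2
  have h2 := le_ciSup (Set.finite_range fun i => |grad φ x i|).bddAbove i
  simp only [grad] at h h2
  linarith

/-- A smooth approximation of the cone `C ∑ |y_i - x_i|` with vertex `x`. -/
def smoothCone (C δ : ℝ) (x y : EuclideanSpace ℝ (Fin n)) : ℝ :=
  C * ∑ i, √((y i - x i) ^ 2 + δ ^ 2)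

lemma contDiff_smoothCone {δ : ℝ} (C : ℝ) (hδ : 0 < δ) (x : EuclideanSpace ℝ (Fin n)) :
    ContDiff ℝ 2 (smoothCone C δ x) := by
  refine contDiff_const.mul (ContDiff.sum fun i _ => ContDiff.sqrt ?_ fun y => by positivity)
  fun_prop

lemma partialDeriv_smoothCone {δ : ℝ} (C : ℝ) (hδ : 0 < δ) (x y : EuclideanSpace ℝ (Fin n))
    (i : Fin n) : partialDeriv i (smoothCone C δ x) y =
      C * ((y i - x i) / √((y i - x i) ^ 2 + δ ^ 2)) := by
  have hj : ∀ j, HasFDerivAt (fun y : EuclideanSpace ℝ (Fin n) => √((y j - x j) ^ 2 + δ ^ 2))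
      (((y j - x j) / √((y j - x j) ^ 2 + δ ^ 2)) • EuclideanSpace.proj (𝕜 := ℝ) j) y := by
    intro j
    have h1 : HasFDerivAt (fun y : EuclideanSpace ℝ (Fin n) => y j - x j)
        (EuclideanSpace.proj (𝕜 := ℝ) j) y :=
      ((EuclideanSpace.proj (𝕜 := ℝ) j).hasFDerivAt (x := y)).sub_const (x j)
    have h2 := ((h1.pow 2).add_const (δ ^ 2)).sqrt (by positivity)
    refine h2.congr_fderiv ?_
    rw [smul_smul]
    congr 1
    simp
    field_simp
  rw [partialDeriv]
  change fderiv ℝ (fun y : EuclideanSpace ℝ (Fin n) => C * ∑ i, √((y i - x i) ^ 2 + δ ^ 2)) y _ = _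
  rw [HasFDerivAt.fderiv ((HasFDerivAt.fun_sum fun j _ => hj j).const_mul C)]
  simp

/-- Because of the constraint on the gradient, a subsolution of linear growth at most one is
Lipschitz with constant one for `∑ |x_i|`. -/
theorem IsSubsolution.le_add_l1norm {σ A : Matrix (Fin n) (Fin n) ℝ} {lam : ℝ}
    {u : EuclideanSpace ℝ (Fin n) → ℝ} (hu : IsSubsolution σ A lam u)
    (hgrowth : limsup (fun x => ((growthRatio u x : ℝ) : EReal))
      (Bornology.cobounded (EuclideanSpace ℝ (Fin n))) ≤ 1)
    (x z : EuclideanSpace ℝ (Fin n)) : u z ≤ u x + l1norm (z - x) := by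
  have hC : ∀ C : ℝ, 1 < C → u z ≤ u x + C * l1norm (z - x) := by
    intro C hC
    have hC2 : 0 < C ^ 2 - 1 := by nlinarith
    -- the maximum of `u` minus a cone steeper than one is attained close to the vertex
    have touch : ∀ δ, 0 < δ → ∃ y, u z - smoothCone C δ x z ≤ u y ∧
        ‖y - x‖ ≤ n * (δ / √(C ^ 2 - 1)) := by
      intro δ hδ
      have hcone : ∀ y, C * l1norm (y - x) ≤ smoothCone C δ x y := fun y => by
        refine mul_le_mul_of_nonneg_left (Finset.sum_le_sum fun i _ => ?_) (by linarith)
        refine Real.le_sqrt_of_sq_le ?_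
        simp only [PiLp.sub_apply, sq_abs]
        nlinarith
      obtain ⟨R, hR⟩ := exists_le_mul_l1norm hgrowth (C := (1 + C) / 2) (by linarith)
      have husc : UpperSemicontinuous fun y => u y - smoothCone C δ x y := by
        simpa only [sub_eq_add_neg, Pi.neg_apply] using hu.1.add
          (contDiff_smoothCone C hδ x).continuous.neg.upperSemicontinuous
      obtain ⟨y, hy⟩ := exists_forall_le_of_coercive husc (z := z)
        (R := max R ((C * l1norm x - (u z - smoothCone C δ x z)) / ((C - 1) / 2))) (by
          intro y hy
          have h1 := hR y ((le_max_left _ _).trans hy.le)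
          have h2 := (div_lt_iff₀ (by linarith)).1 ((le_max_right _ _).trans_lt hy)
          have h3 := hcone y
          have h4 : l1norm y ≤ l1norm (y - x) + l1norm x := by
            simpa using l1norm_add_le (y - x) x
          have h5 := mul_le_mul_of_nonneg_left h4 (by linarith : 0 ≤ C)
          have h6 := mul_le_mul_of_nonneg_left (norm_le_l1norm y) (by linarith : 0 ≤ (C - 1) / 2)
          linarith)
      refine ⟨y, ?_, ?_⟩
      · have h1 := hy z
        have h2 := hcone y
        have h3 := l1norm_nonneg (y - x)
        have : 0 ≤ C * l1norm (y - x) := by positivity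
        linarith
      · refine (norm_le_l1norm _).trans ?_
        have hi : ∀ i, |(y - x) i| ≤ δ / √(C ^ 2 - 1) := by
          intro i
          have h1 := hu.abs_partialDeriv_le (contDiff_smoothCone C hδ x)
            (Eventually.of_forall hy : IsLocalMax _ y) i
          have hpos : 0 < √((y i - x i) ^ 2 + δ ^ 2) := Real.sqrt_pos.2 (by positivity)
          rw [partialDeriv_smoothCone C hδ, ← mul_div_assoc, abs_div, abs_of_pos hpos,
            div_le_one hpos] at h1
          have h2 := Real.sq_sqrt (by positivity : 0 ≤ (y i - x i) ^ 2 + δ ^ 2)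
          have h3 := pow_le_pow_left₀ (abs_nonneg _) h1 2
          rw [sq_abs, h2] at h3
          rw [le_div_iff₀ (Real.sqrt_pos.2 hC2)]
          refine abs_le_of_sq_le_sq' ?_ hδ.le |>.2
          rw [mul_pow, Real.sq_sqrt hC2.le, sq_abs, PiLp.sub_apply]
          nlinarith
        have := Finset.sum_le_card_nsmul Finset.univ (fun i => |(y - x) i|) _ (fun i _ => hi i)
        simpa [l1norm] using this
    refine le_of_forall_pos_le_add fun e he => ?_
    obtain ⟨r, hr, hru⟩ := Metric.eventually_nhds_iff.1 (hu.1 x (u x + e) (by linarith))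
    have hlim1 : Tendsto (fun δ : ℝ => n * (δ / √(C ^ 2 - 1))) (𝓝[>] 0) (𝓝 0) := by
      have : Continuous fun δ : ℝ => n * (δ / √(C ^ 2 - 1)) := by fun_prop
      simpa using (this.tendsto 0).mono_left nhdsWithin_le_nhds
    have hlim2 : Tendsto (fun δ : ℝ => u x + e + smoothCone C δ x z) (𝓝[>] 0)
        (𝓝 (u x + e + C * l1norm (z - x))) := by
      have : Continuous fun δ : ℝ => u x + e + smoothCone C δ x z := by
        unfold smoothCone; fun_prop
      have h := (this.tendsto 0).mono_left (nhdsWithin_le_nhds (s := Set.Ioi 0))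
      simpa [smoothCone, l1norm, Real.sqrt_sq_eq_abs] using h
    have : u z ≤ u x + e + C * l1norm (z - x) := by
      refine ge_of_tendsto hlim2 ?_
      filter_upwards [hlim1.eventually (gt_mem_nhds hr), self_mem_nhdsWithin] with δ h1 h2
      obtain ⟨y, hy1, hy2⟩ := touch δ h2
      have := hru (y := y) (by rw [dist_eq_norm]; exact hy2.trans_lt h1)
      linarith
    linarith
  have hlim : Tendsto (fun C : ℝ => u x + C * l1norm (z - x)) (𝓝[>] 1)
      (𝓝 (u x + 1 * l1norm (z - x))) :=
    (Continuous.tendsto (by fun_prop) 1).mono_left nhdsWithin_le_nhds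
  rw [one_mul] at hlim
  exact ge_of_tendsto hlim (eventually_mem_nhdsWithin.mono fun C => hC C)

lemma continuous_of_le_add_l1norm {u : EuclideanSpace ℝ (Fin n) → ℝ}
    (hu : ∀ x z, u z ≤ u x + l1norm (z - x)) : Continuous u := by
  refine (LipschitzWith.of_le_add_mul n fun x y => ?_).continuous
  rw [dist_eq_norm]
  simpa using (hu y x).trans (add_le_add_right (l1norm_le _) _)

/-! ### The equation in terms of directional derivatives -/

section formula

variable {E : Type*} [NormedAddCommGroup E] [NormedSpace ℝ E]

lemma contDiff_dirDeriv {φ : E → ℝ} (hφ : ContDiff ℝ 2 φ) (q : E) :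
    ContDiff ℝ 1 (dirDeriv q φ) :=
  (hφ.fderiv_right (m := 1) (by norm_num)).clm_apply contDiff_const

lemma dirDeriv_const_mul (c : ℝ) (q : E) (φ : E → ℝ) :
    dirDeriv q (fun x => c * φ x) = fun x => c * dirDeriv q φ x := by
  ext x
  have : (fun x => c * φ x) = c • φ := rfl
  simp [dirDeriv, this, fderiv_const_smul_field]

lemma dirDeriv_smul (c : ℝ) (q : E) (φ : E → ℝ) :
    dirDeriv (c • q) φ = fun x => c * dirDeriv q φ x := by
  ext x; simp [dirDeriv]

lemma dirDeriv_log {φ ψ : E → ℝ} {x : E} (hφ : ContDiff ℝ 2 φ) (hx : 0 < φ x)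
    (hψ : ψ =ᶠ[𝓝 x] fun y => Real.log (φ y)) (q : E) :
    dirDeriv q ψ =ᶠ[𝓝 x] fun y => dirDeriv q φ y / φ y := by
  refine (dirDeriv_congr hψ).trans ?_
  filter_upwards [hφ.continuous.continuousAt.eventually (lt_mem_nhds hx)] with y hy
  rw [dirDeriv, fderiv.log (hφ.differentiable (by norm_num) y) hy.ne']
  simp [dirDeriv, div_eq_inv_mul]

lemma dirDeriv_dirDeriv_log {φ ψ : E → ℝ} {x : E} (hφ : ContDiff ℝ 2 φ) (hx : 0 < φ x)
    (hψ : ψ =ᶠ[𝓝 x] fun y => Real.log (φ y)) (q : E) :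
    dirDeriv q (dirDeriv q ψ) x =
      dirDeriv q (dirDeriv q φ) x / φ x - (dirDeriv q φ x / φ x) ^ 2 := by
  rw [(dirDeriv_congr (dirDeriv_log hφ hx hψ q)).eq_of_nhds, dirDeriv]
  have h1 := ((contDiff_dirDeriv hφ q).differentiable (by norm_num) x).hasFDerivAt
  have h2 := (hφ.differentiable (by norm_num) x).hasFDerivAt
  have h3 : HasFDerivAt (fun y => dirDeriv q φ y / φ y) _ x :=
    h1.mul ((hasDerivAt_inv hx.ne').comp_hasFDerivAt x h2)
  rw [h3.fderiv]
  simp only [add_apply, smul_apply, smul_eq_mul]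
  simp only [dirDeriv]
  field_simp
  ring

end formula

/-- The `k`-th column of `A σ`; the second order part of the equation is
`-½ ∑ ∂²` along these vectors. -/
def noiseDir (σ A : Matrix (Fin n) (Fin n) ℝ) (k : Fin n) : EuclideanSpace ℝ (Fin n) :=
  WithLp.toLp 2 fun i => (A * σ) i k

lemma dirDeriv_eq_sum (q : EuclideanSpace ℝ (Fin n)) (φ : EuclideanSpace ℝ (Fin n) → ℝ)
    (x : EuclideanSpace ℝ (Fin n)) : dirDeriv q φ x = ∑ i, q i * partialDeriv i φ x := by
  have : q = ∑ i, q i • EuclideanSpace.single i (1 : ℝ) := by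
    ext j; simp [Pi.single_apply]
  conv_lhs => rw [this]
  simp [dirDeriv, partialDeriv, map_sum]

lemma dirDeriv_dirDeriv_eq_sum (q : EuclideanSpace ℝ (Fin n))
    {φ : EuclideanSpace ℝ (Fin n) → ℝ} (hφ : ContDiff ℝ 2 φ) (x : EuclideanSpace ℝ (Fin n)) :
    dirDeriv q (dirDeriv q φ) x = ∑ i, ∑ j, q i * hess φ x i j * q j := by
  have e : dirDeriv q φ = fun y => ∑ j, q j * partialDeriv j φ y := by
    ext y; exact dirDeriv_eq_sum q φ y
  rw [dirDeriv_eq_sum]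
  refine Finset.sum_congr rfl fun i _ => ?_
  have hd : HasFDerivAt (fun y => ∑ j, q j * partialDeriv j φ y)
      (∑ j, q j • fderiv ℝ (partialDeriv j φ) x) x := HasFDerivAt.fun_sum fun j _ =>
    (((contDiff_dirDeriv hφ (EuclideanSpace.single j 1)).differentiable (by norm_num)
      x).hasFDerivAt.const_mul (q j))
  rw [e, partialDeriv, hd.fderiv]
  simp only [sum_apply, smul_apply, smul_eq_mul,
    Finset.mul_sum]
  refine Finset.sum_congr rfl fun j _ => ?_
  rw [hess, Matrix.of_apply, mul_assoc, mul_comm (q j)]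
  rfl

lemma trace_eq_sum {σ A : Matrix (Fin n) (Fin n) ℝ} (hA : A.IsSymm)
    {φ : EuclideanSpace ℝ (Fin n) → ℝ} (hφ : ContDiff ℝ 2 φ) (x : EuclideanSpace ℝ (Fin n)) :
    (σ * σ.transpose * (A + A * hess φ x * A +
      Matrix.vecMulVec (x.ofLp + A.mulVec (grad φ x)) (x.ofLp + A.mulVec (grad φ x)))).trace =
    (σ * σ.transpose * A).trace + ∑ k, (dirDeriv (noiseDir σ A k) (dirDeriv (noiseDir σ A k) φ) x
      + (σ.transpose.mulVec x.ofLp k + dirDeriv (noiseDir σ A k) φ x) ^ 2) := by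
  have h1 : (σ * σ.transpose * (A * hess φ x * A)).trace =
      ∑ k, dirDeriv (noiseDir σ A k) (dirDeriv (noiseDir σ A k) φ) x := by
    have : (σ * σ.transpose * (A * hess φ x * A)).trace =
        ((A * σ).transpose * hess φ x * (A * σ)).trace := by
      rw [Matrix.transpose_mul, hA.eq, mul_assoc σ, Matrix.trace_mul_comm]
      simp only [mul_assoc]
    rw [this, Matrix.trace]
    refine Finset.sum_congr rfl fun k _ => ?_
    rw [dirDeriv_dirDeriv_eq_sum _ hφ, Matrix.diag_apply, Matrix.mul_apply, Finset.sum_comm]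
    refine Finset.sum_congr rfl fun j _ => ?_
    rw [Matrix.mul_apply, Finset.sum_mul]
    rfl
  have h2 : ∀ c : Fin n → ℝ, (σ * σ.transpose * Matrix.vecMulVec c c).trace =
      ∑ k, (σ.transpose.mulVec c k) ^ 2 := by
    intro c
    rw [mul_assoc, Matrix.trace_mul_comm, Matrix.mul_vecMulVec, Matrix.vecMulVec_mul,
      Matrix.trace_vecMulVec, dotProduct]
    refine Finset.sum_congr rfl fun k _ => ?_
    rw [← Matrix.mulVec_transpose, pow_two]
  have h3 : ∀ k, σ.transpose.mulVec (x.ofLp + A.mulVec (grad φ x)) k =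
      σ.transpose.mulVec x.ofLp k + dirDeriv (noiseDir σ A k) φ x := by
    intro k
    rw [Matrix.mulVec_add, Pi.add_apply, Matrix.mulVec_mulVec, dirDeriv_eq_sum]
    congr 1
    have : σ.transpose * A = (A * σ).transpose := by rw [Matrix.transpose_mul, hA.eq]
    rw [this]
    rfl
  rw [mul_add, mul_add, Matrix.trace_add, Matrix.trace_add, h1, h2, add_assoc,
    ← Finset.sum_add_distrib]
  simp only [h3]

lemma genOp_noiseDir [NeZero n] (σ A : Matrix (Fin n) (Fin n) ℝ) (b : EuclideanSpace ℝ (Fin n))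
    (φ : EuclideanSpace ℝ (Fin n) → ℝ) (x : EuclideanSpace ℝ (Fin n)) :
    genOp b (fun k => √n • noiseDir σ A k) φ x = dirDeriv b φ x +
      2⁻¹ * ∑ k, dirDeriv (noiseDir σ A k) (dirDeriv (noiseDir σ A k) φ) x := by
  have hn : (n : ℝ) ≠ 0 := by exact_mod_cast NeZero.ne n
  simp only [genOp_apply, dirDeriv_smul, dirDeriv_const_mul, Fintype.card_fin, Finset.mul_sum]
  congr 1
  refine Finset.sum_congr rfl fun k _ => ?_
  rw [← mul_assoc (√(n : ℝ)), Real.mul_self_sqrt (Nat.cast_nonneg n)]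
  field_simp

section smoothing

/-! ### Smooth approximate subsolutions -/

/-- `log φ` near a point where `φ > 0`, extended to a `C²` function on the whole space. -/
lemma exists_contDiff_eq_log {E : Type*} [NormedAddCommGroup E] [NormedSpace ℝ E]
    [FiniteDimensional ℝ E] {φ : E → ℝ} (hφ : ContDiff ℝ 2 φ) {x : E} (hx : 0 < φ x) :
    ∃ ψ : E → ℝ, ContDiff ℝ 2 ψ ∧ ψ =ᶠ[𝓝 x] fun y => Real.log (φ y) := by
  obtain ⟨r, hr, hpos⟩ := Metric.eventually_nhds_iff.1
    (hφ.continuous.continuousAt.eventually (lt_mem_nhds hx))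
  let χ : ContDiffBump x := ⟨r / 2, r, by positivity, by linarith⟩
  refine ⟨fun y => Real.log (χ y * φ y + (1 - χ y)), ?_, ?_⟩
  · have hχ : ContDiff ℝ 2 χ := χ.contDiff (n := 2)
    refine ((hχ.mul hφ).add (contDiff_const.sub hχ)).log fun y => ne_of_gt ?_
    rcases lt_or_ge (dist y x) r with h | h
    · have h1 := hpos h
      have h2 : 0 < χ y := χ.pos_of_mem_ball h
      have h3 := χ.le_one (x := y)
      nlinarith
    · simp [χ.zero_of_le_dist h]
  · filter_upwards [χ.eventuallyEq_one] with y hy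
    simp [hy]

variable {σ A : Matrix (Fin n) (Fin n) ℝ} {lam : ℝ} {u : EuclideanSpace ℝ (Fin n) → ℝ}

/-- The coefficient of `w` in the linear inequality satisfied by `w = exp u`. -/
def potential (σ A : Matrix (Fin n) (Fin n) ℝ) (lam : ℝ) (x : EuclideanSpace ℝ (Fin n)) : ℝ :=
  lam - 2⁻¹ * (σ * σ.transpose * A).trace - 2⁻¹ * ∑ k, σ.transpose.mulVec x.ofLp k ^ 2

/-- The drift of the linear inequality satisfied by `exp u`. -/
def drift (σ A : Matrix (Fin n) (Fin n) ℝ) (x : EuclideanSpace ℝ (Fin n)) :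
    EuclideanSpace ℝ (Fin n) :=
  ∑ k, σ.transpose.mulVec x.ofLp k • noiseDir σ A k

lemma dirDeriv_drift (x y : EuclideanSpace ℝ (Fin n)) (φ : EuclideanSpace ℝ (Fin n) → ℝ) :
    dirDeriv (drift σ A x) φ y =
      ∑ k, σ.transpose.mulVec x.ofLp k * dirDeriv (noiseDir σ A k) φ y := by
  simp [dirDeriv, drift, map_sum]

/-- The nonlinear expression in `log φ` is linear in `φ`, up to division by `φ`. -/
lemma sum_dirDeriv_log {φ ψ : EuclideanSpace ℝ (Fin n) → ℝ} {x : EuclideanSpace ℝ (Fin n)}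
    (hφ : ContDiff ℝ 2 φ) (hx : 0 < φ x) (hψ : ψ =ᶠ[𝓝 x] fun y => Real.log (φ y)) :
    ∑ k, (dirDeriv (noiseDir σ A k) (dirDeriv (noiseDir σ A k) ψ) x
      + (σ.transpose.mulVec x.ofLp k + dirDeriv (noiseDir σ A k) ψ x) ^ 2) =
      (∑ k, dirDeriv (noiseDir σ A k) (dirDeriv (noiseDir σ A k) φ) x
        + 2 * ∑ k, σ.transpose.mulVec x.ofLp k * dirDeriv (noiseDir σ A k) φ x) / φ x
        + ∑ k, σ.transpose.mulVec x.ofLp k ^ 2 := by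
  rw [Finset.mul_sum, ← Finset.sum_add_distrib, Finset.sum_div, ← Finset.sum_add_distrib]
  refine Finset.sum_congr rfl fun k _ => ?_
  rw [dirDeriv_dirDeriv_log hφ hx hψ, (dirDeriv_log hφ hx hψ _).eq_of_nhds]
  ring

lemma abs_dirDeriv_le {φ : EuclideanSpace ℝ (Fin n) → ℝ} {x : EuclideanSpace ℝ (Fin n)} {C : ℝ}
    (h : ∀ i, |partialDeriv i φ x| ≤ C) (q : EuclideanSpace ℝ (Fin n)) :
    |dirDeriv q φ x| ≤ l1norm q * C := by
  rw [dirDeriv_eq_sum, l1norm, Finset.sum_mul]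
  refine (Finset.abs_sum_le_sum_abs _ _).trans (Finset.sum_le_sum fun i _ => ?_)
  rw [abs_mul]
  exact mul_le_mul_of_nonneg_left (h i) (abs_nonneg _)

/-- The substitution `w = exp u` makes the second order part of the equation linear: the square
of the gradient is absorbed by the second derivatives of `log`.  The drift may be frozen at a
nearby point `x₀`, because the constraint on the gradient bounds the derivatives of the test
function. -/
lemma IsSubsolution.touchesAbove_exp [NeZero n] (hA : A.IsSymm) (hu : IsSubsolution σ A lam u)
    (x₀ x : EuclideanSpace ℝ (Fin n)) :
    TouchesAbove (drift σ A x₀) (fun k => √n • noiseDir σ A k)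
      (potential σ A lam x * Real.exp (u x) - ∑ k, |σ.transpose.mulVec x.ofLp k
        - σ.transpose.mulVec x₀.ofLp k| * (l1norm (noiseDir σ A k) * Real.exp (u x)))
      (fun y => Real.exp (u y)) x := by
  intro φ hφ hmax
  set φ₁ : EuclideanSpace ℝ (Fin n) → ℝ := fun y => φ y + (Real.exp (u x) - φ x) with hφ₁
  have hφ₁s : ContDiff ℝ 2 φ₁ := (hφ.of_le (by norm_cast)).add contDiff_const
  have hφ₁x : φ₁ x = Real.exp (u x) := by simp [hφ₁]
  have hpos : 0 < φ₁ x := hφ₁x ▸ Real.exp_pos _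
  obtain ⟨ψ, hψ, hψe⟩ := exists_contDiff_eq_log hφ₁s hpos
  have hψmax : IsLocalMax (fun y => u y - ψ y) x := by
    filter_upwards [hmax, hψe] with y h1 h2
    have h3 : Real.exp (u y) ≤ φ₁ y := by simp only [hφ₁]; linarith
    have h4 : u y ≤ ψ y := by rw [h2, ← Real.log_exp (u y)]; gcongr
    rw [hψe.eq_of_nhds, hφ₁x, Real.log_exp]
    linarith
  have hd : ∀ p, dirDeriv p φ₁ = dirDeriv p φ := fun p => by
    ext y; simp [dirDeriv, hφ₁]
  have hgrad : ∀ i, |partialDeriv i φ x| ≤ Real.exp (u x) := by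
    intro i
    have h1 := hu.abs_partialDeriv_le hψ hψmax i
    have h2 : partialDeriv i ψ x = partialDeriv i φ x / Real.exp (u x) := by
      have := (dirDeriv_log hφ₁s hpos hψe (EuclideanSpace.single i 1)).eq_of_nhds
      rwa [hd, hφ₁x] at this
    rwa [h2, abs_div, Real.abs_exp, div_le_one (Real.exp_pos _)] at h1
  have h := (max_le_iff.1 (hu.2 x ψ hψ hψmax)).1
  rw [trace_eq_sum hA hψ] at h
  rw [sum_dirDeriv_log hφ₁s hpos hψe] at h
  simp only [hd, hφ₁x] at h
  have h' : potential σ A lam x * Real.exp (u x) ≤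
      2⁻¹ * ∑ k, dirDeriv (noiseDir σ A k) (dirDeriv (noiseDir σ A k) φ) x
        + ∑ k, σ.transpose.mulVec x.ofLp k * dirDeriv (noiseDir σ A k) φ x := by
    have := Real.exp_pos (u x)
    rw [← le_div_iff₀ this, potential]
    have e : ∀ s t : ℝ, (2⁻¹ * s + t) / Real.exp (u x) = 2⁻¹ * ((s + 2 * t) / Real.exp (u x)) :=
      fun s t => by ring
    rw [e]
    linarith
  rw [genOp_noiseDir, dirDeriv_drift]
  have hdiff : ∑ k, σ.transpose.mulVec x.ofLp k * dirDeriv (noiseDir σ A k) φ x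
      - ∑ k, σ.transpose.mulVec x₀.ofLp k * dirDeriv (noiseDir σ A k) φ x ≤
      ∑ k, |σ.transpose.mulVec x.ofLp k - σ.transpose.mulVec x₀.ofLp k|
        * (l1norm (noiseDir σ A k) * Real.exp (u x)) := by
    rw [← Finset.sum_sub_distrib]
    refine Finset.sum_le_sum fun k _ => ?_
    rw [← sub_mul]
    refine (le_abs_self _).trans ?_
    rw [abs_mul]
    exact mul_le_mul_of_nonneg_left (abs_dirDeriv_le hgrad _) (abs_nonneg _)
  linarith

lemma exists_modulus {M : EuclideanSpace ℝ (Fin n) → EuclideanSpace ℝ (Fin n) → ℝ}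
    (hM : Continuous fun p : EuclideanSpace ℝ (Fin n) × EuclideanSpace ℝ (Fin n) => M p.1 p.2)
    (R : ℝ) {e : ℝ} (he : 0 < e) : ∃ ρ, 0 < ρ ∧ ∀ x₀ ∈ closedBall (0 : EuclideanSpace ℝ (Fin n)) R,
      ∀ x ∈ ball x₀ ρ, |M x₀ x - M x₀ x₀| ≤ e := by
  have hc : IsCompact (closedBall (0 : EuclideanSpace ℝ (Fin n)) R ×ˢ
      closedBall (0 : EuclideanSpace ℝ (Fin n)) (R + 1)) :=
    (isCompact_closedBall _ _).prod (isCompact_closedBall _ _)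
  obtain ⟨ρ, hρ, h⟩ := Metric.uniformContinuousOn_iff.1
    (hc.uniformContinuousOn_of_continuous hM.continuousOn) e he
  refine ⟨min ρ 1, by positivity, fun x₀ hx₀ x hx => ?_⟩
  have hx' := mem_ball.1 hx
  rw [mem_closedBall] at hx₀
  have hx1 : dist x 0 ≤ R + 1 := by
    linarith [dist_triangle x x₀ 0, min_le_right ρ 1]
  exact (h (x₀, x) ⟨by simpa using hx₀, by simpa using hx1⟩ (x₀, x₀)
    ⟨by simpa using hx₀, by simp at hx₀ ⊢; linarith⟩ (by
      rw [Prod.dist_eq, dist_self, max_eq_right dist_nonneg]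
      exact hx'.trans_le (min_le_left _ _))).le

lemma continuous_mulVec_apply (M : Matrix (Fin n) (Fin n) ℝ) (k : Fin n) :
    Continuous fun x : EuclideanSpace ℝ (Fin n) => M.mulVec x.ofLp k := by
  simp only [Matrix.mulVec, dotProduct]
  fun_prop

lemma continuous_potential : Continuous (potential σ A lam) := by
  have := continuous_mulVec_apply σ.transpose
  unfold potential
  fun_prop

lemma mollify_exp_add_le (hlip : ∀ x z, u z ≤ u x + l1norm (z - x))
    (ζ : ContDiffBump (0 : EuclideanSpace ℝ (Fin n))) (x d : EuclideanSpace ℝ (Fin n)) :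
    mollify ζ (fun y => Real.exp (u y)) (x + d) ≤
      Real.exp (l1norm d) * mollify ζ (fun y => Real.exp (u y)) x := by
  have hw : Continuous fun y => Real.exp (u y) := (continuous_of_le_add_l1norm hlip).rexp
  rw [mollify_apply, mollify_apply, ← integral_const_mul]
  refine integral_mono (integrable_mollify ζ hw _) ((integrable_mollify ζ hw x).const_mul _)
    fun t => ?_
  have h1 : Real.exp (u (x + d - t)) ≤ Real.exp (l1norm d) * Real.exp (u (x - t)) := by
    rw [← Real.exp_add]
    gcongr
    have := hlip (x - t) (x + d - t)
    rw [show x + d - t - (x - t) = d by abel] at this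
    linarith
  have h2 := mul_le_mul_of_nonneg_left h1 (ζ.nonneg_normed (μ := volume) t)
  simp only
  linarith

lemma abs_partialDeriv_le_of_le_add {U : EuclideanSpace ℝ (Fin n) → ℝ} (hU : Differentiable ℝ U)
    (hlip : ∀ x d, U (x + d) ≤ U x + l1norm d) (x : EuclideanSpace ℝ (Fin n)) (i : Fin n) :
    |partialDeriv i U x| ≤ 1 := by
  have hd := hasDerivAt_line hU x (EuclideanSpace.single i 1) 0
  have hs : ∀ s : ℝ, l1norm (s • EuclideanSpace.single i (1 : ℝ)) = |s| := fun s => by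
    simp [l1norm, apply_ite abs]
  have hl : LipschitzWith 1 fun s : ℝ => U (x + s • EuclideanSpace.single i (1 : ℝ)) := by
    refine LipschitzWith.of_le_add_mul 1 fun s t => ?_
    have := hlip (x + t • EuclideanSpace.single i (1 : ℝ))
      ((s - t) • EuclideanSpace.single i (1 : ℝ))
    rw [hs, add_assoc, ← add_smul, add_sub_cancel] at this
    simpa [Real.dist_eq] using this
  have := norm_deriv_le_of_lipschitz (x₀ := 0) hl
  rw [hd.deriv] at this
  simpa [dirDeriv, partialDeriv] using this

/-- A Lipschitz subsolution can be approximated by `C²` functions that satisfy the constraint on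
the gradient and, on a given ball, the second order inequality up to an arbitrarily small error.
They are the logarithms of mollifications of `exp u`. -/
theorem IsSubsolution.exists_smooth_approx [NeZero n] (hA : A.IsSymm)
    (hu : IsSubsolution σ A lam u) (hlip : ∀ x z, u z ≤ u x + l1norm (z - x)) (R : ℝ) {e : ℝ}
    (he : 0 < e) : ∃ U : EuclideanSpace ℝ (Fin n) → ℝ, ContDiff ℝ 2 U ∧ (∀ x, |U x - u x| ≤ 1) ∧
      (∀ x i, |partialDeriv i U x| ≤ 1) ∧ ∀ x ∈ closedBall (0 : EuclideanSpace ℝ (Fin n)) R,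
        lam - e ≤ 2⁻¹ * ((σ * σ.transpose * A).trace
          + ∑ k, (dirDeriv (noiseDir σ A k) (dirDeriv (noiseDir σ A k) U) x
            + (σ.transpose.mulVec x.ofLp k + dirDeriv (noiseDir σ A k) U x) ^ 2)) := by
  have huc : Continuous u := continuous_of_le_add_l1norm hlip
  set w : EuclideanSpace ℝ (Fin n) → ℝ := fun y => Real.exp (u y) with hwdef
  have hw : Continuous w := huc.rexp
  have hn : (0 : ℝ) < n := by exact_mod_cast NeZero.pos n
  obtain ⟨m, hm, hmle⟩ : ∃ m, 0 < m ∧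
      ∀ x ∈ closedBall (0 : EuclideanSpace ℝ (Fin n)) R, m ≤ w x := by
    rcases (closedBall (0 : EuclideanSpace ℝ (Fin n)) R).eq_empty_or_nonempty with h0 | h0
    · exact ⟨1, one_pos, fun x hx => by simp [h0] at hx⟩
    · obtain ⟨z, -, hz⟩ := (isCompact_closedBall (0 : EuclideanSpace ℝ (Fin n)) R).exists_isMinOn
        h0 hw.continuousOn
      exact ⟨w z, Real.exp_pos _, fun x hx => hz hx⟩
  -- errors of size `η` in the inequality for `exp u` become errors of size at most `e`
  -- after division by the mollification of `exp u`, which is at least `m / exp 1`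
  set η : ℝ := e * m / (2 * Real.exp 1) with hη
  have hη0 : 0 < η := by positivity
  have hcont := continuous_mulVec_apply σ.transpose
  have hpot : Continuous (potential σ A lam) := continuous_potential
  obtain ⟨ρ₁, hρ₁, H₁⟩ := exists_modulus (M := fun x₀ x => potential σ A lam x * w x
    - ∑ k, |σ.transpose.mulVec x.ofLp k - σ.transpose.mulVec x₀.ofLp k|
      * (l1norm (noiseDir σ A k) * w x)) (by fun_prop) R hη0
  obtain ⟨ρ₂, hρ₂, H₂⟩ := exists_modulus (M := fun x₀ x => potential σ A lam x₀ * w x)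
    (by fun_prop) R hη0
  set r : ℝ := min (min (ρ₁ / 4) ρ₂) (1 / n) with hr
  have hr0 : 0 < r := by positivity
  let ζ : ContDiffBump (0 : EuclideanSpace ℝ (Fin n)) := ⟨r / 2, r, by positivity, by linarith⟩
  have hζ : ζ.rOut = r := rfl
  set W := mollify ζ w with hWdef
  have hWs : ContDiff ℝ 2 W := (contDiff_mollify ζ hw).of_le (by norm_cast)
  have hnear : ∀ x : EuclideanSpace ℝ (Fin n), ∀ y ∈ ball x ζ.rOut, l1norm (y - x) ≤ 1 := by
    intro x y hy
    rw [mem_ball, dist_eq_norm, hζ] at hy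
    have h1 : r ≤ 1 / n := min_le_right _ _
    calc l1norm (y - x) ≤ n * ‖y - x‖ := l1norm_le _
      _ ≤ n * (1 / n) := by gcongr; linarith
      _ = 1 := by field_simp
  have hWle : ∀ x, W x ≤ Real.exp (u x + 1) := by
    intro x
    have := mollify_le_add ζ (f := w) (g := fun _ => 0) hw continuous_const (x := x)
      (c := Real.exp (u x + 1)) (fun y hy => by
        rw [zero_add]
        exact Real.exp_le_exp.2 ((hlip x y).trans (by linarith [hnear x y hy])))
    rwa [mollify_const, zero_add] at this
  have hWge : ∀ x, Real.exp (u x - 1) ≤ W x := by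
    intro x
    have := mollify_le_add ζ (f := fun _ => Real.exp (u x - 1)) (g := w) continuous_const hw
      (x := x) (c := 0) (fun y hy => by
        rw [add_zero]
        refine Real.exp_le_exp.2 ?_
        have h1 := hlip y x
        rw [← neg_sub y x, l1norm_neg] at h1
        linarith [hnear x y hy])
    rwa [mollify_const, add_zero] at this
  have hWpos : ∀ x, 0 < W x := fun x => (Real.exp_pos _).trans_le (hWge x)
  have hU2 : ContDiff ℝ 2 fun x => Real.log (W x) := hWs.log fun x => (hWpos x).ne'
  refine ⟨fun x => Real.log (W x), hU2, fun x => ?_, fun x i => ?_, fun x hx => ?_⟩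
  · have h1 := Real.log_le_log (hWpos x) (hWle x)
    have h2 := Real.log_le_log (Real.exp_pos _) (hWge x)
    rw [Real.log_exp] at h1 h2
    rw [abs_le]
    constructor <;> linarith
  · refine abs_partialDeriv_le_of_le_add (hU2.differentiable (by norm_num)) (fun x d => ?_) x i
    have := Real.log_le_log (hWpos _) (mollify_exp_add_le hlip ζ x d)
    rwa [Real.log_mul (Real.exp_pos _).ne' (hWpos x).ne', Real.log_exp, add_comm (l1norm d)] at this
  · have hgen : potential σ A lam x * w x - η ≤
        genOp (drift σ A x) (fun k => √n • noiseDir σ A k) W x := by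
      refine le_genOp_mollify ζ hw hρ₁ (fun y hy φ hφ hmax => ?_)
        (hζ.trans_le ((min_le_left _ _).trans (min_le_left _ _)))
      have h1 := (abs_le.1 (H₁ x hx y hy)).1
      have h2 := hu.touchesAbove_exp hA x y φ hφ hmax
      simp only [sub_self, abs_zero, zero_mul, Finset.sum_const_zero, sub_zero] at h1
      linarith
    have hpotW : potential σ A lam x * W x ≤ potential σ A lam x * w x + η := by
      have := mollify_le_add ζ (f := fun y => potential σ A lam x * w y)
        (g := fun _ => potential σ A lam x * w x) (by fun_prop) continuous_const (x := x) (c := η)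
        (fun y hy => by
          have := (abs_le.1 (H₂ x hx y (ball_subset_ball
            (hζ.trans_le ((min_le_left _ _).trans (min_le_right _ _))) hy))).2
          linarith)
      rw [mollify_const] at this
      refine le_trans (le_of_eq ?_) this
      rw [mollify_apply, hWdef, mollify_apply, ← integral_const_mul]
      congr 1; ext t; ring
    have hηW : 2 * η ≤ e * W x := by
      have h1 : m / Real.exp 1 ≤ W x := by
        refine le_trans ?_ (hWge x)
        rw [Real.exp_sub]
        gcongr
        exact hmle x hx
      calc 2 * η = e * (m / Real.exp 1) := by rw [hη]; field_simp
        _ ≤ e * W x := by gcongr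
    rw [genOp_noiseDir, dirDeriv_drift] at hgen
    rw [sum_dirDeriv_log hWs (hWpos x) (EventuallyEq.refl _ _)]
    have hdiv : potential σ A lam x - e ≤
        (∑ k, σ.transpose.mulVec x.ofLp k * dirDeriv (noiseDir σ A k) W x
        + 2⁻¹ * ∑ k, dirDeriv (noiseDir σ A k) (dirDeriv (noiseDir σ A k) W) x) / W x := by
      rw [le_div_iff₀ (hWpos x)]
      linarith
    have e1 : ∀ s t : ℝ, (t + 2⁻¹ * s) / W x = 2⁻¹ * ((s + 2 * t) / W x) :=
      fun s t => by ring
    rw [e1, potential] at hdiv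
    linarith

end smoothing

/-! ### Comparison of eigenvalues -/

variable {σ A : Matrix (Fin n) (Fin n) ℝ} {lam mu : ℝ} {u v : EuclideanSpace ℝ (Fin n) → ℝ}

/-- At a minimum of `v - τ U`, with `U` a smooth approximate subsolution, `τ U` is a test function
for `v` whose gradient does not saturate the constraint, so that the second order inequality
holds for `τ U` with `mu`.  Compared with the inequality for `U`, the quadratic dependence
on the gradient costs at most a multiple of `1 - τ`. -/
lemma exists_mul_sub_le [NeZero n] (hA : A.IsSymm) (hu : IsSubsolution σ A lam u)
    (hv : IsSupersolution σ A mu v)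
    (hgu : limsup (fun x => ((growthRatio u x : ℝ) : EReal))
      (Bornology.cobounded (EuclideanSpace ℝ (Fin n))) ≤ 1)
    (hgv : 1 ≤ liminf (fun x => ((growthRatio v x : ℝ) : EReal))
      (Bornology.cobounded (EuclideanSpace ℝ (Fin n)))) :
    ∃ K, ∀ τ, 0 < τ → τ < 1 → τ * lam - mu ≤ (1 - τ) * K := by
  refine ⟨2⁻¹ * |(σ * σ.transpose * A).trace|
    + 2⁻¹ * ∑ k, l1norm (noiseDir σ A k) ^ 2 + 1, fun τ h0 h1 => ?_⟩
  have hlip := hu.le_add_l1norm hgu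
  obtain ⟨R₁, hR₁⟩ := exists_le_mul_l1norm hgu (C := 1 + (1 - τ) / 4) (by linarith)
  obtain ⟨R₂, hR₂⟩ := exists_mul_l1norm_le hgv (C := 1 - (1 - τ) / 4) (by linarith)
  set R := max (max R₁ R₂) ((v 0 - τ * u 0 + 2) / ((1 - τ) / 2)) with hR
  obtain ⟨U, hU2, hUu, hUd, hU⟩ := hu.exists_smooth_approx hA hlip R
    (by linarith : 0 < 1 - τ)
  have hτ : ∀ x, |τ * U x - τ * u x| ≤ 1 := fun x => by
    rw [← mul_sub, abs_mul, abs_of_pos h0]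
    nlinarith [hUu x, abs_nonneg (U x - u x)]
  have hfar : ∀ y, R < ‖y‖ → v 0 - τ * U 0 < v y - τ * U y := by
    intro y hy
    have a1 := hR₁ y (((le_max_left _ _).trans (le_max_left _ _)).trans hy.le)
    have a2 := hR₂ y (((le_max_right _ _).trans (le_max_left _ _)).trans hy.le)
    have a3 := (div_lt_iff₀ (by linarith)).1 ((le_max_right _ _).trans_lt hy)
    have a4 := norm_le_l1norm y
    have a5 := (abs_le.1 (hτ y)).2
    have a6 := (abs_le.1 (hτ 0)).1
    have a7 := mul_le_mul_of_nonneg_left a1 h0.le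
    have a8 : (1 - τ) / 2 * l1norm y ≤
        (1 - (1 - τ) / 4) * l1norm y - τ * ((1 + (1 - τ) / 4) * l1norm y) := by
      have : 0 ≤ (1 - τ) ^ 2 * l1norm y := mul_nonneg (sq_nonneg _) (l1norm_nonneg y)
      nlinarith
    have a9 := mul_le_mul_of_nonneg_left a4 (by linarith : 0 ≤ (1 - τ) / 2)
    linarith
  have hψ2 : ContDiff ℝ 2 fun x => τ * U x := contDiff_const.mul hU2
  obtain ⟨y, hy⟩ := exists_forall_le_of_coercive (f := fun y => τ * U y - v y) (R := R) (z := 0)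
    (by simpa only [sub_eq_add_neg, Pi.neg_apply] using
      hψ2.continuous.upperSemicontinuous.add hv.1.neg)
    (fun y hy => by linarith [hfar y hy])
  have hyR : y ∈ closedBall (0 : EuclideanSpace ℝ (Fin n)) R := by
    rw [mem_closedBall_zero_iff]
    by_contra hcon
    linarith [hfar y (not_le.1 hcon), hy 0]
  have hmin : IsLocalMin (fun z => v z - τ * U z) y :=
    Eventually.of_forall fun z => by linarith [hy z]
  have hsup := hv.2 y _ hψ2 hmin
  have hgrad : (⨆ i, |grad (fun x => τ * U x) y i|) - 1 < 0 := by
    have : (⨆ i, |grad (fun x => τ * U x) y i|) ≤ τ := by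
      refine ciSup_le fun i => ?_
      have e : grad (fun x => τ * U x) y i = τ * partialDeriv i U y :=
        congrFun (dirDeriv_const_mul τ (EuclideanSpace.single i 1) U) y
      rw [e, abs_mul, abs_of_pos h0]
      exact mul_le_of_le_one_right h0.le (hUd y i)
    linarith
  have h2 := (le_max_iff.1 hsup).resolve_right (not_le.2 hgrad)
  rw [trace_eq_sum hA hψ2] at h2
  simp only [dirDeriv_const_mul] at h2
  have h3 := mul_le_mul_of_nonneg_left (hU y hyR) h0.le
  have h4 : τ * ∑ k, (dirDeriv (noiseDir σ A k) (dirDeriv (noiseDir σ A k) U) y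
            + (σ.transpose.mulVec y.ofLp k + dirDeriv (noiseDir σ A k) U y) ^ 2)
      - ∑ k, (τ * dirDeriv (noiseDir σ A k) (dirDeriv (noiseDir σ A k) U) y
            + (σ.transpose.mulVec y.ofLp k + τ * dirDeriv (noiseDir σ A k) U y) ^ 2)
      ≤ (1 - τ) * ∑ k, l1norm (noiseDir σ A k) ^ 2 := by
    rw [Finset.mul_sum, Finset.mul_sum, ← Finset.sum_sub_distrib]
    refine Finset.sum_le_sum fun k _ => ?_
    have b1 : dirDeriv (noiseDir σ A k) U y ^ 2 ≤ l1norm (noiseDir σ A k) ^ 2 := by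
      rw [← sq_abs]
      gcongr
      simpa using abs_dirDeriv_le (hUd y) (noiseDir σ A k)
    have b2 : 0 ≤ (1 - τ) * σ.transpose.mulVec y.ofLp k ^ 2 :=
      mul_nonneg (by linarith) (sq_nonneg _)
    have b3 := mul_le_mul_of_nonneg_left b1 (by linarith : 0 ≤ 1 - τ)
    have b4 : 0 ≤ (1 - τ) * ((1 - τ) * dirDeriv (noiseDir σ A k) U y ^ 2) :=
      mul_nonneg (by linarith) (mul_nonneg (by linarith) (sq_nonneg _))
    linarith
  have h5 := mul_le_mul_of_nonneg_left (neg_abs_le (σ * σ.transpose * A).trace)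
    (by linarith : 0 ≤ 1 - τ)
  have h6 : 0 ≤ (1 - τ) * (1 - τ) := mul_nonneg (by linarith) (by linarith)
  linarith

/-- In dimension zero the equation reads `max lam (-1) = 0`. -/
lemma IsSubsolution.le_of_dim_zero {σ A : Matrix (Fin 0) (Fin 0) ℝ} {lam mu : ℝ}
    {u v : EuclideanSpace ℝ (Fin 0) → ℝ} (hu : IsSubsolution σ A lam u)
    (hv : IsSupersolution σ A mu v) : lam ≤ mu := by
  have h1 := hu.2 0 (fun _ => 0) contDiff_const
    (Eventually.of_forall fun y => by rw [Subsingleton.elim y 0])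
  have h2 := hv.2 0 (fun _ => 0) contDiff_const
    (Eventually.of_forall fun y => by rw [Subsingleton.elim y 0])
  simp only [correctorOp, Matrix.trace, Finset.univ_eq_empty, Finset.sum_empty, mul_zero, sub_zero,
    Real.iSup_of_isEmpty, zero_sub, max_le_iff, le_max_iff] at h1 h2
  rcases h2 with h2 | h2 <;> linarith [h1.1]

theorem IsSubsolution.eigenvalue_le (hA : A.IsSymm) (hu : IsSubsolution σ A lam u)
    (hv : IsSupersolution σ A mu v)
    (hgu : limsup (fun x => ((growthRatio u x : ℝ) : EReal))
      (Bornology.cobounded (EuclideanSpace ℝ (Fin n))) ≤ 1)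
    (hgv : 1 ≤ liminf (fun x => ((growthRatio v x : ℝ) : EReal))
      (Bornology.cobounded (EuclideanSpace ℝ (Fin n)))) : lam ≤ mu := by
  rcases n.eq_zero_or_pos with rfl | hn
  · exact hu.le_of_dim_zero hv
  · have : NeZero n := ⟨hn.ne'⟩
    obtain ⟨K, hK⟩ := exists_mul_sub_le hA hu hv hgu hgv
    have hlim : Tendsto (fun τ : ℝ => (1 - τ) * K - (τ * lam - mu)) (𝓝[<] 1)
        (𝓝 ((1 - 1) * K - (1 * lam - mu))) :=
      (Continuous.tendsto (by fun_prop) 1).mono_left nhdsWithin_le_nhds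
    have := ge_of_tendsto hlim (b := 0) (by
      filter_upwards [Ioo_mem_nhdsLT (zero_lt_one' ℝ)] with τ hτ
      linarith [hK τ hτ.1 hτ.2])
    linarith

lemma limsup_growthRatio_le (h : Tendsto (growthRatio u)
    (Bornology.cobounded (EuclideanSpace ℝ (Fin n))) (𝓝 1)) :
    limsup (fun x => ((growthRatio u x : ℝ) : EReal))
      (Bornology.cobounded (EuclideanSpace ℝ (Fin n))) ≤ 1 := by
  refine le_of_forall_gt_imp_ge_of_dense fun c hc => limsup_le_of_le (h := ?_)
  have := (continuous_coe_real_ereal.tendsto 1).comp h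
  exact (this.eventually (gt_mem_nhds (by simpa using hc))).mono fun x hx => hx.le

lemma le_liminf_growthRatio (h : Tendsto (growthRatio u)
    (Bornology.cobounded (EuclideanSpace ℝ (Fin n))) (𝓝 1)) :
    1 ≤ liminf (fun x => ((growthRatio u x : ℝ) : EReal))
      (Bornology.cobounded (EuclideanSpace ℝ (Fin n))) := by
  refine le_of_forall_lt_imp_le_of_dense fun c hc => le_liminf_of_le (h := ?_)
  have := (continuous_coe_real_ereal.tendsto 1).comp h
  exact (this.eventually (lt_mem_nhds (by simpa using hc))).mono fun x hx => hx.le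

end CorrectorEigenvalue

end

theorem proposition2p2 {n : ℕ} (σ A : Matrix (Fin n) (Fin n) ℝ)
    (hσ : σ.det ≠ 0) (hA : A.IsSymm) :
    (∀ (lam mu : ℝ) (u v : EuclideanSpace ℝ (Fin n) → ℝ),
      CorrectorEigenvalue.IsSubsolution σ A lam u →
      CorrectorEigenvalue.IsSupersolution σ A mu v →
      limsup (fun x => ((CorrectorEigenvalue.growthRatio u x : ℝ) : EReal))
        (Bornology.cobounded (EuclideanSpace ℝ (Fin n))) ≤ 1 →
      1 ≤ liminf (fun x => ((CorrectorEigenvalue.growthRatio v x : ℝ) : EReal))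
        (Bornology.cobounded (EuclideanSpace ℝ (Fin n))) →
      lam ≤ mu) ∧
    (∀ (lam₁ lam₂ : ℝ) (u₁ u₂ : EuclideanSpace ℝ (Fin n) → ℝ),
      CorrectorEigenvalue.IsSolution σ A lam₁ u₁ →
      Tendsto (CorrectorEigenvalue.growthRatio u₁)
        (Bornology.cobounded (EuclideanSpace ℝ (Fin n))) (𝓝 1) →
      CorrectorEigenvalue.IsSolution σ A lam₂ u₂ →
      Tendsto (CorrectorEigenvalue.growthRatio u₂)
        (Bornology.cobounded (EuclideanSpace ℝ (Fin n))) (𝓝 1) →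
      lam₁ = lam₂) := by
  refine ⟨fun lam mu u v hu hv hgu hgv => hu.eigenvalue_le hA hv hgu hgv,
    fun lam₁ lam₂ u₁ u₂ h₁ hg₁ h₂ hg₂ => le_antisymm ?_ ?_⟩
  · exact h₁.2.1.eigenvalue_le hA h₂.2.2 (CorrectorEigenvalue.limsup_growthRatio_le hg₁)
      (CorrectorEigenvalue.le_liminf_growthRatio hg₂)
  · exact h₂.2.1.eigenvalue_le hA h₁.2.2 (CorrectorEigenvalue.limsup_growthRatio_le hg₂)
      (CorrectorEigenvalue.le_liminf_growthRatio hg₁)
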